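/- **Theorem 1.** Let $n\ge 0$, $\delta=x\,\frac{d}{dx}$, and let $F(x,y_0,\dots,y_n)$ be holomorphic in a polydisc $\Delta=\{|x|<\rho,\ |y_j|<\varepsilon_j,\ j=0,\dots,n\}$, where $0<\rho<\infty$ and $0<\varepsilon_j\le\infty$. Let $\eta\in\mathbb R\setminus\{0\}$ and let $$\varphi=\sum_{k=0}^\infty \alpha_k(x^{\mathrm i\eta})\,x^k$$ be an exotic formal series, that is, all $\alpha_k(t)$ are holomorphic in one common punctured disc $\mathcal D=\{0<|t|<r\}$ and meromorphic at $t=0$. With $t=x^{\mathrm i\eta}$, the derivation $\delta$ acts on such series termwise by $\delta\bigl(\alpha(t)x^k\bigr)=\bigl(k\,\alpha(t)+\mathrm i\eta\,t\,\alpha'(t)\bigr)x^k$. Put $\Phi=(\varphi,\delta\varphi,\dots,\delta^n\varphi)$ and let $\Phi_0(t)$ be the tuple of the coefficients of $x^0$ in $\Phi$. Suppose that $(0,\Phi_0(t))\in\Delta$ for all sufficiently small $t\neq0$, so that $F(x,\Phi)$ and $\frac{\partial F}{\partial y_i}(x,\Phi)$ are defined, by Taylor expansion in $x$, as formal power series in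 $x$ whose coefficients are functions of $t$ in a punctured neighbourhood of $0$. Suppose that $\varphi$ is a formal solution of the equation $F(x,y,\delta y,\dots,\delta^n y)=0$, that is, $F(x,\Phi)=0$. Suppose further that, for some integer $N\ge0$ and for all $i=0,\dots,n$, $$\frac{\partial F}{\partial y_i}(x,\Phi)=B_i(x^{\mathrm i\eta})\,x^N+D_i(x^{\mathrm i\eta})\,x^{N+1}+\dots,$$ with the same $N$ for all $i$, where the $B_i$ are meromorphic at $0$, $B_n\not\equiv0$ (in particular $\frac{\partial F}{\partial y_n}(x,\Phi)\not\equiv0$), and $$\operatorname{ord}_0B_i\ge\operatorname{ord}_0B_n,\qquad i=0,\dots,n$$ (with $\operatorname{ord}_0 0=+\infty$). Then there are an open sector $S\subset\mathbb C\setminus\mathbb R_+$ with vertex at the origin and of sufficiently small radius, where $\mathbb R_+=[0,\infty)$, and a branch of $\log x$ on $\mathbb C\setminus\mathbb R_+$ such that, with $x^{\mathrm i\eta}=e^{\mathrm i\eta\log x}$ for this branch, one has $x^{\mathrm i\eta}\in\mathcal D$ for all $x\in S$ and the series $\sum_{k\ge0}\alpha_k(x^{\mathrm i\eta})x^k$ converges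 uniformly on $S$. -/

import Mathlib

open Filter Topology
open scoped ENNReal

noncomputable section

namespace Exotic

/-- The polydisc `|x| < ρ`, `|y_j| < ε_j` for `j = 0, …, n`; the radii `ε_j` may be infinite, so
that functions polynomial in the `y_j` can be regarded on the whole `y`-space. -/
def polydisc {n : ℕ} (ρ : ℝ) (ε : Fin (n + 1) → ℝ≥0∞) : Set (ℂ × (Fin (n + 1) → ℂ)) :=
  {p | ‖p.1‖ < ρ ∧ ∀ j, ‖p.2 j‖ₑ < ε j}

/-- The punctured disc `0 < |t| < r`. -/
def puncturedDisc (r : ℝ) : Set ℂ :=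
  {t | 0 < ‖t‖ ∧ ‖t‖ < r}

/-- A sequence `α` stands for the formal series `∑ k, α k (x ^ (i η)) x ^ k`. It is exotic if the
`α k` are meromorphic at the origin and holomorphic in the common punctured disc `0 < |t| < r`. -/
def IsExoticSeries (r : ℝ) (α : ℕ → ℂ → ℂ) : Prop :=
  ∀ k, MeromorphicAt (α k) 0 ∧ DifferentiableOn ℂ (α k) (puncturedDisc r)

/-- The derivation `δ = x d/dx` on formal series: with `t = x ^ (i η)`,
`δ (a(t) x ^ k) = (k a(t) + i η t a'(t)) x ^ k`. -/
def delta (η : ℝ) (α : ℕ → ℂ → ℂ) : ℕ → ℂ → ℂ :=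
  fun k t => (k : ℂ) * α k t + Complex.I * (η : ℂ) * t * deriv (α k) t

/-- The tuple `Φ = (φ, δ φ, …, δ ^ n φ)`. -/
def jet (n : ℕ) (η : ℝ) (α : ℕ → ℂ → ℂ) : Fin (n + 1) → ℕ → ℂ → ℂ :=
  fun i => (delta η)^[(i : ℕ)] α

/-- The coefficient (a function of `t`) of `x ^ k` in the formal series `G(x, Y)`, where
`Y i = ∑ j, Y i j t * x ^ j`. As it depends only on the terms of `Y` of degree at most `k` in `x`,
it is the `k`-th Taylor coefficient at `x = 0` of the function obtained by substituting the
truncations of the `Y i`. It is meaningful when `G` is holomorphic at `(0, Y · 0 t)`. -/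
def substCoeff {n : ℕ} (G : ℂ × (Fin (n + 1) → ℂ) → ℂ) (Y : Fin (n + 1) → ℕ → ℂ → ℂ)
    (k : ℕ) (t : ℂ) : ℂ :=
  iteratedDeriv k
    (fun x : ℂ => G (x, fun i => ∑ j ∈ Finset.range (k + 1), Y i j t * x ^ j)) 0 / (k.factorial : ℂ)

/-- The partial derivative `∂F/∂y_i`. -/
def partialY {n : ℕ} (F : ℂ × (Fin (n + 1) → ℂ) → ℂ) (i : Fin (n + 1)) :
    ℂ × (Fin (n + 1) → ℂ) → ℂ :=
  fun p => fderiv ℂ F p (0, Pi.single i 1)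

/-- `φ` is a formal solution of `F(x, y, δ y, …, δ ^ n y) = 0`, with `F` given on `Δ`: near `t = 0`
the leading terms of `(x, Φ)` lie in `Δ`, so that `F(x, Φ)` makes sense, and all the coefficients
of `F(x, Φ)` vanish. -/
def IsFormalSolution {n : ℕ} (Δ : Set (ℂ × (Fin (n + 1) → ℂ))) (F : ℂ × (Fin (n + 1) → ℂ) → ℂ)
    (η : ℝ) (α : ℕ → ℂ → ℂ) : Prop :=
  ∀ᶠ t in 𝓝[≠] (0 : ℂ),
    ((0 : ℂ), fun i => jet n η α i 0 t) ∈ Δ ∧ ∀ k, substCoeff F (jet n η α) k t = 0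

/-- The open sector `0 < |x| < R`, `θ₁ < arg x < θ₂` with vertex at the origin. -/
def openSector (R θ₁ θ₂ : ℝ) : Set ℂ :=
  {x | ∃ r θ : ℝ, 0 < r ∧ r < R ∧ θ₁ < θ ∧ θ < θ₂ ∧ x = (r : ℂ) * Complex.exp ((θ : ℂ) * Complex.I)}

/-- The ray `ℝ_+ = [0, ∞)` in the complex plane. -/
def nonnegRay : Set ℂ :=
  {x | 0 ≤ x.re ∧ x.im = 0}

/-- The branch of the logarithm on `ℂ ∖ ℝ_+` whose imaginary part lies in `(2πm, 2π(m+1))`;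
each branch of the logarithm on `ℂ ∖ ℝ_+` is one of these. -/
def branchLog (m : ℤ) (x : ℂ) : ℂ :=
  Complex.log (-x) + (2 * (m : ℂ) + 1) * (Real.pi : ℂ) * Complex.I

/-- The corresponding branch of `x ^ (i η)` on `ℂ ∖ ℝ_+`. -/
def branchPow (m : ℤ) (η : ℝ) (x : ℂ) : ℂ :=
  Complex.exp (Complex.I * (η : ℂ) * branchLog m x)

end Exotic

end

/-! The modulus of `x ^ (iη)` depends only on `arg x`. A suitable branch therefore maps a whole
sector into a closed annulus `A` about `0`, so close to `0` that on it everything is holomorphic and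
`B_n` has no zeros. It then suffices to bound `α k` on `A` geometrically in `k`; the Weierstrass
M-test does the rest.

For the bound, subtract from `φ` its terms of degree at most `M` and write the remainder as `x ^ M *
y`. Since `δ (x ^ M y) = x ^ M (M + δ) y`, the jet of the remainder is `x ^ M` times the tuple `y_i
= (M + δ) ^ i y`. Take `v = y_n` as the unknown. The operator `M + δ` is inverted by integrating
along the flow of `δ`, which rotates `t` because `η` is real and so preserves `A`. On bounded
functions this inverse has norm at most `1 / M`.

Taylor expansion of `F` gives `F(x, Φ_M + x ^ M y) = x ^ (M + N) (∑ B_i y_i + O(x))`. Dividing by `x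
^ (M + N) B_n` gives a fixed-point equation for `v`. Its linear part contains only `y_i` with `i <
n`, each carrying a factor `1 / M`, and the quotients `B_i / B_n` are bounded on `A`. Hence for `M`
large and `|x| < s` small the map is a contraction with constant `1 / 2` (`exists_isContractive`).

No limit of the iterates is needed. They are holomorphic in `x` and bounded by `1` for `0 < |x| <
s`, while long truncations of the formal solution are fixed points up to a high power of `x`. On a
small disc the iterates are thus close to the truncations, and Cauchy estimates on the large and the
small disc transfer the bound to the formal coefficients (`IsContractive.norm_coeff_le`,
`exists_norm_coeff_le`). -/

noncomputable section

namespace Exotic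

open MeasureTheory Set Asymptotics

/-! ### Inverting `M + δ` on bounded functions -/

/-- Integration along the flow `(x, t) ↦ (e^{-u} x, e^{-iηu} t)`; it inverts the operator
`M + x ∂/∂x + iη t ∂/∂t` on bounded functions. -/
def flowInt (M : ℕ) (η : ℝ) (v : ℂ → ℂ → ℂ) (x t : ℂ) : ℂ :=
  ∫ u in Ioi (0 : ℝ), Complex.exp (-(M * u : ℝ)) *
    v (Complex.exp (-u) * x) (Complex.exp (-(Complex.I * η * u)) * t)

/-- Functions of `(x, t)`, `0 < |x| < ρ`, `t ∈ A`, that are jointly continuous, holomorphic in `x`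
and bounded by `C`. -/
structure Admissible (A : Set ℂ) (ρ C : ℝ) (v : ℂ → ℂ → ℂ) : Prop where
  cont : ContinuousOn (fun p : ℂ × ℂ => v p.1 p.2) (puncturedDisc ρ ×ˢ A)
  diff : ∀ t ∈ A, DifferentiableOn ℂ (fun x => v x t) (puncturedDisc ρ)
  bound : ∀ x ∈ puncturedDisc ρ, ∀ t ∈ A, ‖v x t‖ ≤ C

/-- Invariance of a set under rotations about the origin. -/
def RotInvariant (A : Set ℂ) : Prop := ∀ t ∈ A, ∀ z : ℂ, ‖z‖ = 1 → z * t ∈ A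

theorem isOpen_puncturedDisc (r : ℝ) : IsOpen (puncturedDisc r) :=
  (isOpen_lt continuous_const continuous_norm).inter (isOpen_lt continuous_norm continuous_const)

theorem exp_neg_mul_mem_puncturedDisc {ρ u : ℝ} {x : ℂ} (hu : 0 ≤ u) (hx : x ∈ puncturedDisc ρ) :
    Complex.exp (-u) * x ∈ puncturedDisc ρ := by
  have h1 : ‖Complex.exp (-(u : ℂ))‖ = Real.exp (-u) := by
    rw [Complex.norm_exp]; simp
  have h2 : Real.exp (-u) ≤ 1 := Real.exp_le_one_iff.2 (by linarith)
  refine ⟨?_, ?_⟩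
  · rw [norm_mul, h1]; exact mul_pos (Real.exp_pos _) hx.1
  · rw [norm_mul, h1]
    exact (mul_le_of_le_one_left (norm_nonneg _) h2).trans_lt hx.2

theorem RotInvariant.exp_mul_mem {A : Set ℂ} (hA : RotInvariant A) {t : ℂ} (ht : t ∈ A)
    (η u : ℝ) : Complex.exp (-(Complex.I * η * u)) * t ∈ A := by
  refine hA t ht _ ?_
  rw [Complex.norm_exp]; simp

theorem Admissible.mono_radius {A : Set ℂ} {ρ ρ' C : ℝ} {v : ℂ → ℂ → ℂ} (hv : Admissible A ρ C v)
    (h : ρ' ≤ ρ) : Admissible A ρ' C v := by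
  have hs : puncturedDisc ρ' ⊆ puncturedDisc ρ := fun x hx => ⟨hx.1, hx.2.trans_le h⟩
  exact ⟨hv.cont.mono (prod_mono hs subset_rfl), fun t ht => (hv.diff t ht).mono hs,
    fun x hx => hv.bound x (hs hx)⟩

theorem Admissible.of_bound {A : Set ℂ} {ρ C C' : ℝ} {v : ℂ → ℂ → ℂ} (hv : Admissible A ρ C v)
    (h : ∀ x ∈ puncturedDisc ρ, ∀ t ∈ A, ‖v x t‖ ≤ C') : Admissible A ρ C' v :=
  ⟨hv.cont, hv.diff, h⟩

theorem Admissible.sub {A : Set ℂ} {ρ C C' : ℝ} {v w : ℂ → ℂ → ℂ} (hv : Admissible A ρ C v)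
    (hw : Admissible A ρ C' w) : Admissible A ρ (C + C') (fun x t => v x t - w x t) :=
  ⟨hv.cont.sub hw.cont, fun t ht => (hv.diff t ht).sub (hw.diff t ht), fun x hx t ht =>
    (norm_sub_le _ _).trans (add_le_add (hv.bound x hx t ht) (hw.bound x hx t ht))⟩

theorem norm_cexp_neg_mul (M : ℕ) (u : ℝ) :
    ‖Complex.exp (-(M * u : ℝ))‖ = Real.exp (-M * u) := by
  rw [Complex.norm_exp]; simp

theorem integrableOn_mul_exp {M : ℕ} (hM : 0 < M) (C : ℝ) :
    IntegrableOn (fun u : ℝ => C * Real.exp (-M * u)) (Ioi 0) :=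
  (exp_neg_integrableOn_Ioi 0 (by exact_mod_cast hM)).const_mul C

/-- No bound on the derivative is required: the Cauchy estimate on circles of radius `ε / 4` centred
in the half ball derives one from the bound on `f`. -/
theorem differentiableAt_integral_of_dominated {Ω : Type*} [MeasurableSpace Ω] {μ : Measure Ω}
    {f : ℂ → Ω → ℂ} {x : ℂ} {ε : ℝ} (hε : 0 < ε) {bound : Ω → ℝ} (hbi : Integrable bound μ)
    (hmeas : ∀ y ∈ Metric.ball x ε, AEStronglyMeasurable (f y) μ)
    (hd : ∀ᵐ u ∂μ, DifferentiableOn ℂ (fun y => f y u) (Metric.ball x ε))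
    (hb : ∀ᵐ u ∂μ, ∀ y ∈ Metric.ball x ε, ‖f y u‖ ≤ bound u) :
    DifferentiableAt ℂ (fun y => ∫ u, f y u ∂μ) x := by
  have hxm : x ∈ Metric.ball x ε := Metric.mem_ball_self hε
  refine (hasDerivAt_integral_of_dominated_loc_of_deriv_le (s := Metric.ball x (ε / 2))
    (F' := fun y u => deriv (fun y => f y u) y) (bound := fun u => bound u / (ε / 4))
    (Metric.ball_mem_nhds x (half_pos hε)) ?_ ?_ ?_ ?_ (hbi.div_const _) ?_).2.differentiableAt
  · filter_upwards [Metric.ball_mem_nhds x hε] with y hy using hmeas y hy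
  · exact hbi.mono' (hmeas x hxm) (hb.mono fun u hu => hu x hxm)
  -- The derivative at `x` is measurable in the parameter as a pointwise limit of difference
  -- quotients along a sequence tending to `x`.
  · have hseq : Tendsto (fun k : ℕ => x + ((ε / 2 : ℝ) : ℂ) * (1 / ((k : ℂ) + 1))) atTop
        (𝓝[≠] x) := by
      refine tendsto_nhdsWithin_iff.2 ⟨?_, Eventually.of_forall fun k => ?_⟩
      · have h := (tendsto_one_div_add_atTop_nhds_zero_nat (𝕜 := ℂ)).const_mul ((ε / 2 : ℝ) : ℂ)
        simpa using h.const_add x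
      · have : ((k : ℂ) + 1) ≠ 0 := Nat.cast_add_one_ne_zero k
        simp [hε.ne', this]
    have hmem : ∀ᶠ k : ℕ in atTop, x + ((ε / 2 : ℝ) : ℂ) * (1 / ((k : ℂ) + 1)) ∈
        Metric.ball x ε :=
      (hseq.mono_right nhdsWithin_le_nhds).eventually (Metric.ball_mem_nhds x hε)
    obtain ⟨k₀, hk₀⟩ := eventually_atTop.1 hmem
    refine aestronglyMeasurable_of_tendsto_ae atTop (f := fun k u => slope (fun y => f y u) x
      (x + ((ε / 2 : ℝ) : ℂ) * (1 / (((k + k₀ : ℕ) : ℂ) + 1)))) (fun k => ?_) ?_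
    · simp only [slope_def_field, div_eq_mul_inv]
      exact ((hmeas _ (hk₀ _ (Nat.le_add_left _ _))).sub (hmeas x hxm)).mul_const _
    · filter_upwards [hd] with u hu
      have h1 := (hu.differentiableAt (Metric.ball_mem_nhds x hε)).hasDerivAt.tendsto_slope
      exact (h1.comp hseq).comp (tendsto_add_atTop_nat k₀)
  · filter_upwards [hd, hb] with u hu hbu y hy
    have hsub : Metric.closedBall y (ε / 4) ⊆ Metric.ball x ε := by
      intro z hz
      rw [Metric.mem_ball] at *
      rw [Metric.mem_closedBall] at hz
      linarith [dist_triangle z y x]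
    refine Complex.norm_deriv_le_of_forall_mem_sphere_norm_le (by linarith) ?_
      fun z hz => hbu z (hsub (Metric.sphere_subset_closedBall hz))
    exact (hu.mono hsub).diffContOnCl_ball subset_rfl
  · filter_upwards [hd] with u hu y hy
    exact (hu.differentiableAt (Metric.isOpen_ball.mem_nhds
      (Metric.ball_subset_ball (by linarith) hy))).hasDerivAt

section

variable {A : Set ℂ} {ρ C : ℝ} {v : ℂ → ℂ → ℂ} {M : ℕ} {η : ℝ} {x t : ℂ}

theorem Admissible.continuousOn_flow (hA : RotInvariant A) (hv : Admissible A ρ C v)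
    (hx : x ∈ puncturedDisc ρ) (ht : t ∈ A) :
    ContinuousOn (fun u : ℝ => Complex.exp (-(M * u : ℝ)) *
      v (Complex.exp (-u) * x) (Complex.exp (-(Complex.I * η * u)) * t)) (Ioi 0) := by
  refine ContinuousOn.mul (by fun_prop) ?_
  refine hv.cont.comp (f := fun u : ℝ =>
    (Complex.exp (-u) * x, Complex.exp (-(Complex.I * η * u)) * t)) (by fun_prop) ?_
  intro u hu
  exact ⟨exp_neg_mul_mem_puncturedDisc (le_of_lt hu) hx, hA.exp_mul_mem ht η u⟩

theorem Admissible.norm_flow_le (hA : RotInvariant A) (hv : Admissible A ρ C v)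
    (hx : x ∈ puncturedDisc ρ) (ht : t ∈ A) {u : ℝ} (hu : 0 ≤ u) :
    ‖Complex.exp (-(M * u : ℝ)) *
      v (Complex.exp (-u) * x) (Complex.exp (-(Complex.I * η * u)) * t)‖
      ≤ C * Real.exp (-M * u) := by
  rw [norm_mul, norm_cexp_neg_mul, mul_comm]
  exact mul_le_mul_of_nonneg_right (hv.bound _ (exp_neg_mul_mem_puncturedDisc hu hx) _
    (hA.exp_mul_mem ht η u)) (Real.exp_pos _).le

theorem Admissible.integrableOn_flow (hA : RotInvariant A) (hM : 0 < M) (hv : Admissible A ρ C v)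
    (hx : x ∈ puncturedDisc ρ) (ht : t ∈ A) :
    IntegrableOn (fun u : ℝ => Complex.exp (-(M * u : ℝ)) *
      v (Complex.exp (-u) * x) (Complex.exp (-(Complex.I * η * u)) * t)) (Ioi 0) := by
  refine (integrableOn_mul_exp hM C).mono'
    ((hv.continuousOn_flow hA hx ht).aestronglyMeasurable measurableSet_Ioi) ?_
  filter_upwards [ae_restrict_mem measurableSet_Ioi] with u hu
  exact hv.norm_flow_le hA hx ht (le_of_lt hu)

/-- The gain `1 / M` is the integral of `exp (-M u)` over `u > 0`; it is the source of the
contraction. -/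
theorem Admissible.norm_flowInt_le (hA : RotInvariant A) (hM : 0 < M) (hv : Admissible A ρ C v)
    (hx : x ∈ puncturedDisc ρ) (ht : t ∈ A) : ‖flowInt M η v x t‖ ≤ C / M := by
  have hM' : (0 : ℝ) < M := by exact_mod_cast hM
  have h : ∫ u in Ioi (0 : ℝ), C * Real.exp (-M * u) = C / M := by
    rw [integral_const_mul, integral_exp_mul_Ioi (by linarith)]
    simp [div_eq_mul_inv]
  rw [← h]
  refine norm_integral_le_of_norm_le (integrableOn_mul_exp hM C) ?_
  filter_upwards [ae_restrict_mem measurableSet_Ioi] with u hu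
  exact hv.norm_flow_le hA hx ht (le_of_lt hu)

theorem Admissible.flowInt (hA : RotInvariant A) (hM : 0 < M) (hv : Admissible A ρ C v) :
    Admissible A ρ (C / M) (flowInt M η v) := by
  refine ⟨?_, ?_, fun x hx t ht => hv.norm_flowInt_le hA hM hx ht⟩
  · intro p hp
    refine tendsto_integral_filter_of_dominated_convergence
      (fun u => C * Real.exp (-M * u)) ?_ ?_ (integrableOn_mul_exp hM C) ?_
    · filter_upwards [self_mem_nhdsWithin] with q hq
      exact (hv.continuousOn_flow hA hq.1 hq.2).aestronglyMeasurable measurableSet_Ioi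
    · filter_upwards [self_mem_nhdsWithin] with q hq
      filter_upwards [ae_restrict_mem measurableSet_Ioi] with u hu
      exact hv.norm_flow_le hA hq.1 hq.2 (le_of_lt hu)
    · filter_upwards [ae_restrict_mem measurableSet_Ioi] with u hu
      have : ContinuousOn (fun q : ℂ × ℂ => Complex.exp (-(M * u : ℝ)) *
          v (Complex.exp (-u) * q.1) (Complex.exp (-(Complex.I * η * u)) * q.2))
          (puncturedDisc ρ ×ˢ A) := by
        refine ContinuousOn.mul (by fun_prop) ?_
        refine hv.cont.comp (f := fun q : ℂ × ℂ =>
          (Complex.exp (-u) * q.1, Complex.exp (-(Complex.I * η * u)) * q.2)) (by fun_prop) ?_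
        intro q hq
        exact ⟨exp_neg_mul_mem_puncturedDisc (le_of_lt hu) hq.1, hA.exp_mul_mem hq.2 η u⟩
      exact this p hp
  · intro t ht x hx
    obtain ⟨ε, hε, hball⟩ := Metric.isOpen_iff.1 (isOpen_puncturedDisc ρ) x hx
    have hdiff : ∀ u ∈ Ioi (0 : ℝ), DifferentiableOn ℂ (fun x => Complex.exp (-(M * u : ℝ)) *
        v (Complex.exp (-u) * x) (Complex.exp (-(Complex.I * η * u)) * t)) (puncturedDisc ρ) := by
      intro u hu
      refine DifferentiableOn.const_mul ?_ _
      exact (hv.diff _ (hA.exp_mul_mem ht η u)).comp (by fun_prop)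
        (fun y hy => exp_neg_mul_mem_puncturedDisc (le_of_lt hu) hy)
    refine (differentiableAt_integral_of_dominated hε (integrableOn_mul_exp hM C)
      (fun y hy => (hv.continuousOn_flow hA (hball hy) ht).aestronglyMeasurable measurableSet_Ioi)
      ?_ ?_).differentiableWithinAt
    · filter_upwards [ae_restrict_mem measurableSet_Ioi] with u hu
      exact (hdiff u hu).mono hball
    · filter_upwards [ae_restrict_mem measurableSet_Ioi] with u hu y hy
      exact hv.norm_flow_le hA (hball hy) ht (le_of_lt hu)

theorem Admissible.iterate_flowInt (hA : RotInvariant A) (hM : 0 < M) (hC : 0 ≤ C)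
    (hv : Admissible A ρ C v) (k : ℕ) : Admissible A ρ C ((Exotic.flowInt M η)^[k] v) := by
  induction k with
  | zero => exact hv
  | succ k ih =>
    rw [Function.iterate_succ_apply']
    refine (ih.flowInt hA hM).of_bound fun x hx t ht => (ih.norm_flowInt_le hA hM hx ht).trans ?_
    exact div_le_self hC (by exact_mod_cast hM)

theorem Admissible.flowInt_sub {C' : ℝ} {w : ℂ → ℂ → ℂ} (hA : RotInvariant A) (hM : 0 < M)
    (hv : Admissible A ρ C v) (hw : Admissible A ρ C' w)
    (hx : x ∈ puncturedDisc ρ) (ht : t ∈ A) :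
    Exotic.flowInt M η v x t - Exotic.flowInt M η w x t =
      Exotic.flowInt M η (fun x t => v x t - w x t) x t := by
  simp only [Exotic.flowInt]
  rw [← integral_sub (hv.integrableOn_flow hA hM hx ht) (hw.integrableOn_flow hA hM hx ht)]
  simp only [mul_sub]

theorem Admissible.norm_flowInt_sub_le {C' E : ℝ} {w : ℂ → ℂ → ℂ} (hA : RotInvariant A)
    (hM : 0 < M) (hv : Admissible A ρ C v) (hw : Admissible A ρ C' w)
    (hE : ∀ x ∈ puncturedDisc ρ, ∀ t ∈ A, ‖v x t - w x t‖ ≤ E)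
    (hx : x ∈ puncturedDisc ρ) (ht : t ∈ A) :
    ‖Exotic.flowInt M η v x t - Exotic.flowInt M η w x t‖ ≤ E / M := by
  rw [hv.flowInt_sub hA hM hw hx ht]
  exact ((hv.sub hw).of_bound hE).norm_flowInt_le hA hM hx ht

theorem Admissible.norm_iterate_flowInt_sub_le {C' E : ℝ} {w : ℂ → ℂ → ℂ} (hA : RotInvariant A)
    (hM : 0 < M) (hC : 0 ≤ C) (hC' : 0 ≤ C') (hv : Admissible A ρ C v) (hw : Admissible A ρ C' w)
    (hE0 : 0 ≤ E) (hE : ∀ x ∈ puncturedDisc ρ, ∀ t ∈ A, ‖v x t - w x t‖ ≤ E) (k : ℕ) :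
    ∀ x ∈ puncturedDisc ρ, ∀ t ∈ A,
      ‖(Exotic.flowInt M η)^[k] v x t - (Exotic.flowInt M η)^[k] w x t‖ ≤ E := by
  induction k with
  | zero => exact hE
  | succ k ih =>
    intro x hx t ht
    rw [Function.iterate_succ_apply', Function.iterate_succ_apply']
    refine ((hv.iterate_flowInt hA hM hC k).norm_flowInt_sub_le hA hM
      (hw.iterate_flowInt hA hM hC' k) ih hx ht).trans ?_
    exact div_le_self hE0 (by exact_mod_cast hM)

/-- The hypothesis `hd` expresses `v = (M + δ) w` along the orbit of `(x, t)` only, since admissible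
functions need not be differentiable in `t`. The integrand is then an exact derivative, and its
primitive vanishes at infinity because `w` is bounded. -/
theorem flowInt_eq_of_hasDerivAt {C' : ℝ} {w : ℂ → ℂ → ℂ} (hA : RotInvariant A) (hM : 0 < M)
    (hv : Admissible A ρ C v) (hw : Admissible A ρ C' w)
    (hx : x ∈ puncturedDisc ρ) (ht : t ∈ A)
    (hd : ∀ u : ℝ, 0 ≤ u → HasDerivAt (fun u : ℝ => -(Complex.exp (-(M * u : ℝ)) *
        w (Complex.exp (-u) * x) (Complex.exp (-(Complex.I * η * u)) * t)))
      (Complex.exp (-(M * u : ℝ)) *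
        v (Complex.exp (-u) * x) (Complex.exp (-(Complex.I * η * u)) * t)) u) :
    Exotic.flowInt M η v x t = w x t := by
  have hlim : Tendsto (fun u : ℝ => -(Complex.exp (-(M * u : ℝ)) *
        w (Complex.exp (-u) * x) (Complex.exp (-(Complex.I * η * u)) * t))) atTop (𝓝 0) := by
    have h0 : Tendsto (fun u : ℝ => C' * Real.exp (-M * u)) atTop (𝓝 0) := by
      have : Tendsto (fun u : ℝ => (-M : ℝ) * u) atTop atBot :=
        tendsto_id.const_mul_atTop_of_neg (by simpa using hM)
      simpa using (Real.tendsto_exp_atBot.comp this).const_mul C'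
    refine squeeze_zero_norm' ?_ h0
    filter_upwards [eventually_ge_atTop 0] with u hu
    rw [norm_neg]
    exact hw.norm_flow_le hA hx ht hu
  have := integral_Ioi_of_hasDerivAt_of_tendsto' (a := 0) (fun u hu => hd u hu)
    (hv.integrableOn_flow hA hM hx ht) hlim
  rw [Exotic.flowInt, this]
  simp

end

/-! ### Cauchy estimates for Taylor coefficients -/

theorem ball_sdiff_eq_puncturedDisc (r : ℝ) : Metric.ball (0 : ℂ) r \ {0} = puncturedDisc r := by
  ext x
  simp [puncturedDisc, and_comm]

theorem norm_iteratedDeriv_zero_le {f : ℂ → ℂ} {ρ E : ℝ} (hρ : 0 < ρ)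
    (hf : DifferentiableOn ℂ f (Metric.ball 0 ρ)) (hE : ∀ x ∈ puncturedDisc ρ, ‖f x‖ ≤ E)
    (k : ℕ) : ‖iteratedDeriv k f 0‖ ≤ k.factorial * (E * (2 / ρ) ^ k) := by
  refine (Complex.norm_iteratedDeriv_le_of_forall_mem_sphere_norm_le (C := E) k (half_pos hρ)
    (hf.diffContOnCl_ball (Metric.closedBall_subset_ball (by linarith))) ?_).trans_eq ?_
  · intro x hx
    have : ‖x‖ = ρ / 2 := by simpa using hx
    exact hE x ⟨by linarith, by linarith⟩
  · rw [div_pow, div_pow]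
    field_simp

theorem iteratedDeriv_sum_pow_zero (c : ℕ → ℂ) {L k : ℕ} (hk : k < L) :
    iteratedDeriv (k + 1) (fun x : ℂ => ∑ j ∈ Finset.range L, c j * x ^ (j + 1)) 0 =
      (k + 1).factorial * c k := by
  rw [iteratedDeriv_fun_sum (fun i _ => by fun_prop), Finset.sum_eq_single k]
  · rw [iteratedDeriv_const_mul_field, iteratedDeriv_fun_pow_zero]
    simp [mul_comm]
  · intro j _ hj
    rw [iteratedDeriv_const_mul_field, iteratedDeriv_fun_pow_zero]
    simp [hj.symm]
  · simp [hk]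

/-- The bounded function `g` extends holomorphically over `0`. Up to a factorial, `c k` is the
derivative of order `k + 1` at `0` of `g` minus that of `g - ∑ c j x ^ (j + 1)`. The first is
estimated on the circle of radius `s / 2`, the second on that of radius `ρ / 2`. -/
theorem norm_coeff_le {s ρ E : ℝ} (hρ : 0 < ρ) (hρs : ρ ≤ s) {g : ℂ → ℂ}
    (hg : DifferentiableOn ℂ g (puncturedDisc s)) (hb : ∀ x ∈ puncturedDisc s, ‖g x‖ ≤ 1)
    {c : ℕ → ℂ} {L : ℕ}
    (hE : ∀ x ∈ puncturedDisc ρ, ‖g x - ∑ k ∈ Finset.range L, c k * x ^ (k + 1)‖ ≤ E)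
    {k : ℕ} (hk : k < L) : ‖c k‖ ≤ (2 / s) ^ (k + 1) + E * (2 / ρ) ^ (k + 1) := by
  have hs : 0 < s := hρ.trans_le hρs
  set G := Function.update g 0 (limUnder (𝓝[≠] 0) g) with hG
  have hGd : DifferentiableOn ℂ G (Metric.ball 0 s) := by
    refine Complex.differentiableOn_update_limUnder_of_bddAbove (Metric.ball_mem_nhds 0 hs) ?_ ?_
    · rwa [ball_sdiff_eq_puncturedDisc]
    · rw [ball_sdiff_eq_puncturedDisc]
      exact ⟨1, by rintro _ ⟨x, hx, rfl⟩; exact hb x hx⟩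
  have hGe : ∀ x : ℂ, 0 < ‖x‖ → G x = g x := fun x hx =>
    Function.update_of_ne (norm_pos_iff.1 hx) _ _
  set P : ℂ → ℂ := fun x => ∑ k ∈ Finset.range L, c k * x ^ (k + 1) with hP
  have hPd : Differentiable ℂ P := by fun_prop
  have h1 := norm_iteratedDeriv_zero_le (E := 1) hs hGd
    (fun x hx => by rw [hGe x hx.1]; exact hb x hx) (k + 1)
  have h2 := norm_iteratedDeriv_zero_le (f := G - P) (E := E) hρ
    ((hGd.mono (Metric.ball_subset_ball hρs)).sub hPd.differentiableOn)
    (fun x hx => by simp only [Pi.sub_apply]; rw [hGe x hx.1]; exact hE x hx) (k + 1)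
  have hGa : ContDiffAt ℂ (k + 1 : ℕ) G 0 :=
    (hGd.analyticAt (Metric.ball_mem_nhds 0 hs)).contDiffAt
  rw [iteratedDeriv_sub hGa hPd.contDiff.contDiffAt, iteratedDeriv_sum_pow_zero c hk] at h2
  have hf : (0 : ℝ) < (k + 1).factorial := by exact_mod_cast Nat.factorial_pos _
  have h3 : ‖((k + 1).factorial : ℂ) * c k‖ ≤
      (k + 1).factorial * ((2 / s) ^ (k + 1) + E * (2 / ρ) ^ (k + 1)) := by
    have := norm_sub_le (iteratedDeriv (k + 1) G 0)
      (iteratedDeriv (k + 1) G 0 - (k + 1).factorial * c k)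
    rw [sub_sub_cancel] at this
    linarith
  rw [norm_mul, Complex.norm_natCast] at h3
  exact le_of_mul_le_mul_left h3 hf

/-! ### The contraction argument -/

theorem flowInt_congr {A : Set ℂ} (hA : RotInvariant A) {ρ : ℝ} {v w : ℂ → ℂ → ℂ} {M : ℕ} {η : ℝ}
    (h : ∀ x ∈ puncturedDisc ρ, ∀ t ∈ A, v x t = w x t) :
    ∀ x ∈ puncturedDisc ρ, ∀ t ∈ A, flowInt M η v x t = flowInt M η w x t := by
  intro x hx t ht
  refine setIntegral_congr_fun measurableSet_Ioi fun u hu => ?_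
  rw [h _ (exp_neg_mul_mem_puncturedDisc (le_of_lt hu) hx) _ (hA.exp_mul_mem ht η u)]

/-- The tuple obtained from its last entry `v` by inverting `M + δ` repeatedly. -/
def flowJet (n M : ℕ) (η : ℝ) (v : ℂ → ℂ → ℂ) (x t : ℂ) : Fin (n + 1) → ℂ :=
  fun i => (flowInt M η)^[n - i] v x t

/-- Contraction data: a map `Ψ` such that `v ↦ Ψ(x, t, flowJet v)` preserves the unit ball of
the admissible functions and is a contraction there. -/
structure IsContractive {n : ℕ} (M : ℕ) (A : Set ℂ) (s : ℝ)
    (Ψ : ℂ → ℂ → (Fin (n + 1) → ℂ) → ℂ) : Prop where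
  cont : ContinuousOn (fun q : ℂ × ℂ × (Fin (n + 1) → ℂ) => Ψ q.1 q.2.1 q.2.2)
    (puncturedDisc s ×ˢ A ×ˢ Metric.closedBall 0 1)
  diff : ∀ t ∈ A, ∀ x ∈ puncturedDisc s, ∀ y : ℂ → Fin (n + 1) → ℂ, DifferentiableAt ℂ y x →
    ‖y x‖ ≤ 1 → DifferentiableAt ℂ (fun x => Ψ x t (y x)) x
  zero : ∀ x ∈ puncturedDisc s, ∀ t ∈ A, ‖Ψ x t 0‖ ≤ 1 / 2
  lip : ∀ x ∈ puncturedDisc s, ∀ t ∈ A, ∀ y y' : Fin (n + 1) → ℂ, ‖y‖ ≤ 1 → ‖y'‖ ≤ 1 → ∀ E : ℝ,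
    (∀ i, ‖y i - y' i‖ ≤ E) → (∀ i, i ≠ Fin.last n → ‖y i - y' i‖ ≤ E / M) →
    ‖Ψ x t y - Ψ x t y'‖ ≤ E / 2

section

variable {n M : ℕ} {A : Set ℂ} {s ρ : ℝ} {η : ℝ} {Ψ : ℂ → ℂ → (Fin (n + 1) → ℂ) → ℂ}
  {v w : ℂ → ℂ → ℂ}

theorem Admissible.norm_flowJet_le (hA : RotInvariant A) (hM : 0 < M) (hv : Admissible A ρ 1 v)
    {x t : ℂ} (hx : x ∈ puncturedDisc ρ) (ht : t ∈ A) : ‖flowJet n M η v x t‖ ≤ 1 :=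
  (pi_norm_le_iff_of_nonneg zero_le_one).2 fun i =>
    (hv.iterate_flowInt hA hM zero_le_one (n - i)).bound x hx t ht

/-- Every entry of the jet but the last has passed through at least one `flowInt`, which supplies
the `E / M` demanded by `lip`. -/
theorem IsContractive.norm_sub_le (hΨ : IsContractive M A s Ψ) (hA : RotInvariant A) (hM : 0 < M)
    (hρ : ρ ≤ s) (hv : Admissible A ρ 1 v) (hw : Admissible A ρ 1 w) {E : ℝ} (hE0 : 0 ≤ E)
    (hE : ∀ x ∈ puncturedDisc ρ, ∀ t ∈ A, ‖v x t - w x t‖ ≤ E) :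
    ∀ x ∈ puncturedDisc ρ, ∀ t ∈ A,
      ‖Ψ x t (flowJet n M η v x t) - Ψ x t (flowJet n M η w x t)‖ ≤ E / 2 := by
  intro x hx t ht
  refine hΨ.lip x ⟨hx.1, hx.2.trans_le hρ⟩ t ht _ _ (hv.norm_flowJet_le hA hM hx ht)
    (hw.norm_flowJet_le hA hM hx ht) E (fun i => ?_) (fun i hi => ?_)
  · exact hv.norm_iterate_flowInt_sub_le hA hM zero_le_one zero_le_one hw hE0 hE _ x hx t ht
  · obtain ⟨k, hk⟩ : ∃ k, n - (i : ℕ) = k + 1 := by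
      have : (i : ℕ) ≠ n := fun h => hi (Fin.ext h)
      exact ⟨n - i - 1, by omega⟩
    simp only [flowJet, hk, Function.iterate_succ_apply']
    exact (hv.iterate_flowInt hA hM zero_le_one k).norm_flowInt_sub_le hA hM
      (hw.iterate_flowInt hA hM zero_le_one k)
      (hv.norm_iterate_flowInt_sub_le hA hM zero_le_one zero_le_one hw hE0 hE k) hx ht

theorem admissible_zero : Admissible A ρ 1 (fun _ _ => 0) :=
  ⟨continuousOn_const, fun _ _ => differentiableOn_const _, fun _ _ _ _ => by simp⟩

theorem IsContractive.admissible (hΨ : IsContractive M A s Ψ) (hA : RotInvariant A) (hM : 0 < M)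
    (hv : Admissible A s 1 v) : Admissible A s 1 (fun x t => Ψ x t (flowJet n M η v x t)) := by
  have hI := fun k => hv.iterate_flowInt (η := η) hA hM zero_le_one k
  refine ⟨?_, fun t ht x hx => ?_, fun x hx t ht => ?_⟩
  · refine hΨ.cont.comp (f := fun p : ℂ × ℂ => (p.1, p.2, flowJet n M η v p.1 p.2)) ?_ ?_
    · exact continuousOn_fst.prodMk (continuousOn_snd.prodMk
        (continuousOn_pi.2 fun i => (hI (n - i)).cont))
    · intro p hp
      exact ⟨hp.1, hp.2, by simpa using hv.norm_flowJet_le hA hM hp.1 hp.2⟩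
  · refine (hΨ.diff t ht x hx (fun x => flowJet n M η v x t) ?_ (hv.norm_flowJet_le hA hM hx ht)).differentiableWithinAt
    exact differentiableAt_pi.2 fun i => ((hI (n - i)).diff t ht).differentiableAt
      ((isOpen_puncturedDisc s).mem_nhds hx)
  -- Comparison with the zero function: contraction contributes `1 / 2` and the value at `0`
  -- contributes another `1 / 2`.
  · have h1 := hΨ.norm_sub_le (η := η) hA hM le_rfl hv admissible_zero zero_le_one
      (by simpa using hv.bound) x hx t ht
    have h0 : flowJet n M η (fun _ _ => 0) x t = 0 := by
      funext i
      have : ∀ k, (flowInt M η)^[k] (fun _ _ => 0) = fun _ _ => 0 := by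
        intro k
        induction k with
        | zero => rfl
        | succ k ih => rw [Function.iterate_succ_apply', ih]; funext x t; simp [flowInt]
      simp [flowJet, this]
    rw [h0] at h1
    have h2 := hΨ.zero x hx t ht
    have h3 := norm_add_le (Ψ x t (flowJet n M η v x t) - Ψ x t 0) (Ψ x t 0)
    rw [sub_add_cancel] at h3
    linarith

/-- The fixed-point iterates of a contractive map. -/
def contractionIter (M : ℕ) (η : ℝ) (Ψ : ℂ → ℂ → (Fin (n + 1) → ℂ) → ℂ) : ℕ → ℂ → ℂ → ℂ
  | 0 => fun _ _ => 0
  | m + 1 => fun x t => Ψ x t (flowJet n M η (contractionIter M η Ψ m) x t)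

theorem IsContractive.admissible_iter (hΨ : IsContractive M A s Ψ) (hA : RotInvariant A)
    (hM : 0 < M) : ∀ m, Admissible A s 1 (contractionIter M η Ψ m)
  | 0 => admissible_zero
  | m + 1 => hΨ.admissible hA hM (hΨ.admissible_iter hA hM m)

/-- The errors satisfy `e (m + 1) ≤ e m / 2 + E` with `e 0 ≤ 1`. -/
theorem IsContractive.norm_iter_sub_le (hΨ : IsContractive M A s Ψ) (hA : RotInvariant A)
    (hM : 0 < M) (hρ : ρ ≤ s) (hw : Admissible A ρ 1 w) {E : ℝ} (hE0 : 0 ≤ E)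
    (hE : ∀ x ∈ puncturedDisc ρ, ∀ t ∈ A, ‖Ψ x t (flowJet n M η w x t) - w x t‖ ≤ E) (m : ℕ) :
    ∀ x ∈ puncturedDisc ρ, ∀ t ∈ A, ‖contractionIter M η Ψ m x t - w x t‖ ≤
      (1 / 2) ^ m + 2 * E := by
  induction m with
  | zero =>
    intro x hx t ht
    have := hw.bound x hx t ht
    simp only [contractionIter, zero_sub, norm_neg, pow_zero]
    linarith
  | succ m ih =>
    intro x hx t ht
    have h1 := hΨ.norm_sub_le (η := η) hA hM hρ ((hΨ.admissible_iter hA hM m).mono_radius hρ) hw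
      (by positivity) ih x hx t ht
    have h2 := hE x hx t ht
    have h3 := norm_add_le (contractionIter M η Ψ (m + 1) x t - Ψ x t (flowJet n M η w x t))
      (Ψ x t (flowJet n M η w x t) - w x t)
    rw [sub_add_sub_cancel] at h3
    simp only [contractionIter] at h3 ⊢
    rw [pow_succ]
    linarith

/-- If the truncations of the series `∑ z i k t * x ^ (k + 1)` are approximate fixed points of a
contractive map to arbitrarily high order in `x`, then its coefficients grow at most
geometrically. -/
theorem IsContractive.norm_coeff_le (hΨ : IsContractive M A s Ψ) (hA : RotInvariant A)
    (hM : 0 < M) (hs : 0 < s) (z : ℕ → ℕ → ℂ → ℂ)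
    (hz : ∀ k, ∃ L > k, ∃ C ρ₀ : ℝ, 0 < ρ₀ ∧ 0 ≤ C ∧
      Admissible A ρ₀ 1 (fun x t => ∑ j ∈ Finset.range L, z n j t * x ^ (j + 1)) ∧
      (∀ i < n, ∀ x ∈ puncturedDisc ρ₀, ∀ t ∈ A,
        flowInt M η (fun x t => ∑ j ∈ Finset.range L, z (i + 1) j t * x ^ (j + 1)) x t =
          ∑ j ∈ Finset.range L, z i j t * x ^ (j + 1)) ∧
      ∀ x ∈ puncturedDisc ρ₀, ∀ t ∈ A,
        ‖Ψ x t (fun i => ∑ j ∈ Finset.range L, z i j t * x ^ (j + 1)) -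
          ∑ j ∈ Finset.range L, z n j t * x ^ (j + 1)‖ ≤ C * ‖x‖ ^ (k + 2))
    {t : ℂ} (ht : t ∈ A) (k : ℕ) : ‖z 0 k t‖ ≤ (2 / s) ^ (k + 1) := by
  obtain ⟨L, hL, C, ρ₀, hρ₀, hC, hadm, hflow, happ⟩ := hz k
  set w : ℕ → ℂ → ℂ → ℂ := fun i x t => ∑ j ∈ Finset.range L, z i j t * x ^ (j + 1) with hw
  have hiter : ∀ m ≤ n, ∀ x ∈ puncturedDisc ρ₀, ∀ t ∈ A,
      (flowInt M η)^[m] (w n) x t = w (n - m) x t := by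
    intro m
    induction m with
    | zero => intros; rfl
    | succ m ih =>
      intro hm x hx t ht
      rw [Function.iterate_succ_apply', flowInt_congr hA (ih (by omega)) x hx t ht]
      have := hflow (n - (m + 1)) (by omega) x hx t ht
      rwa [show n - (m + 1) + 1 = n - m by omega] at this
  have hjet : ∀ x ∈ puncturedDisc ρ₀, ∀ t ∈ A,
      flowJet n M η (w n) x t = fun i : Fin (n + 1) => w i x t := by
    intro x hx t ht
    funext i
    simp only [flowJet]
    rw [hiter _ (Nat.sub_le _ _) x hx t ht, Nat.sub_sub_self (Nat.lt_succ_iff.1 i.2)]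
  -- The iterate number `m` and the radius `ρ` are independent: the iterates live on the disc of
  -- radius `s`, whereas closeness to the truncation is used only for `|x| < ρ`.
  have main : ∀ ρ, 0 < ρ → ρ ≤ min s ρ₀ → ∀ m : ℕ, ‖z 0 k t‖ ≤ (2 / s) ^ (k + 1) +
      ((1 / 2) ^ m + 2 * (C * ρ ^ (k + 2))) * (2 / ρ) ^ (k + 1) := by
    intro ρ hρ hρm m
    have hρs := hρm.trans (min_le_left _ _)
    have hρρ₀ := hρm.trans (min_le_right _ _)
    have hsub : ∀ x ∈ puncturedDisc ρ, x ∈ puncturedDisc ρ₀ := fun x hx =>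
      ⟨hx.1, hx.2.trans_le hρρ₀⟩
    have hvm := hΨ.admissible_iter (η := η) hA hM m
    have hE : ∀ x ∈ puncturedDisc ρ, ∀ t ∈ A,
        ‖Ψ x t (flowJet n M η (w n) x t) - w n x t‖ ≤ C * ρ ^ (k + 2) := by
      intro x hx t ht
      rw [hjet x (hsub x hx) t ht]
      refine (happ x (hsub x hx) t ht).trans ?_
      have := hx.2.le
      gcongr
    have h1 := hΨ.norm_iter_sub_le hA hM hρs (hadm.mono_radius hρρ₀) (by positivity) hE m
    have h2 := (hvm.mono_radius hρs).norm_iterate_flowInt_sub_le (η := η) hA hM zero_le_one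
      zero_le_one (hadm.mono_radius hρρ₀) (by positivity) h1 n
    have hI := hvm.iterate_flowInt (η := η) hA hM zero_le_one n
    refine Exotic.norm_coeff_le (c := fun j => z 0 j t) (L := L) hρ hρs (hI.diff t ht)
      (fun x hx => hI.bound x hx t ht) (fun x hx => ?_) hL
    have h3 := h2 x hx t ht
    rw [hiter n le_rfl x (hsub x hx) t ht, Nat.sub_self] at h3
    exact h3
  -- First `m → ∞`. In what remains, `ρ ^ (k + 2)` against `(2 / ρ) ^ (k + 1)` leaves one factor
  -- `ρ`, which disappears afterwards as `ρ → 0`.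
  have step : ∀ ρ, 0 < ρ → ρ ≤ min s ρ₀ → ‖z 0 k t‖ ≤ (2 / s) ^ (k + 1) +
      2 ^ (k + 2) * C * ρ := by
    intro ρ hρ hρm
    have hlim : Tendsto (fun m : ℕ => (2 / s) ^ (k + 1) +
        ((1 / 2 : ℝ) ^ m + 2 * (C * ρ ^ (k + 2))) * (2 / ρ) ^ (k + 1)) atTop
        (𝓝 ((2 / s) ^ (k + 1) + (0 + 2 * (C * ρ ^ (k + 2))) * (2 / ρ) ^ (k + 1))) :=
      (((tendsto_pow_atTop_nhds_zero_of_lt_one (by norm_num) (by norm_num)).add_const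
        _).mul_const _).const_add _
    refine (ge_of_tendsto' hlim (main ρ hρ hρm)).trans_eq ?_
    rw [div_pow 2 ρ]
    field_simp
    ring
  have hlim : Tendsto (fun ρ : ℝ => (2 / s) ^ (k + 1) + 2 ^ (k + 2) * C * ρ) (𝓝[>] 0)
      (𝓝 ((2 / s) ^ (k + 1) + 2 ^ (k + 2) * C * 0)) :=
    ((tendsto_id.mono_left nhdsWithin_le_nhds).const_mul _).const_add _
  rw [mul_zero, add_zero] at hlim
  refine ge_of_tendsto hlim ?_
  filter_upwards [Ioc_mem_nhdsGT (lt_min hs hρ₀)] with ρ hρ using step ρ hρ.1 hρ.2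

end

/-! ### Orders in `x` after substituting truncated series -/

theorem isBigO_pow_iff_iteratedDeriv_eq_zero {f : ℂ → ℂ} (hf : AnalyticAt ℂ f 0) (m : ℕ) :
    f =O[𝓝 0] (fun x => x ^ m) ↔ ∀ i < m, iteratedDeriv i f 0 = 0 := by
  rw [← natCast_le_analyticOrderAt_iff_iteratedDeriv_eq_zero hf]
  constructor
  · intro h
    -- If the order were some `k < m`, cancelling `x ^ k` would force the nonvanishing factor `g` to
    -- tend to `0`.
    by_contra! hlt
    have hne : analyticOrderAt f 0 ≠ ⊤ := hlt.ne_top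
    obtain ⟨k, hk⟩ := ENat.ne_top_iff_exists.1 hne
    rw [← hk] at hlt
    have hkm : k < m := by exact_mod_cast hlt
    obtain ⟨g, hg, hg0, hfg⟩ := (hf.analyticOrderAt_eq_natCast).1 hk.symm
    have h1 : (fun x => x ^ k * g x) =O[𝓝 0] (fun x : ℂ => x ^ k * x ^ (m - k)) := by
      refine (h.congr' ?_ ?_)
      · filter_upwards [hfg] with x hx
        simpa using hx
      · exact Eventually.of_forall fun x => by
          simp only; rw [← pow_add, Nat.add_sub_cancel' hkm.le]
    obtain ⟨C, hC⟩ := h1.bound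
    have h2 : ∀ᶠ x in 𝓝[≠] (0 : ℂ), ‖g x‖ ≤ C * ‖x ^ (m - k)‖ := by
      filter_upwards [hC.filter_mono nhdsWithin_le_nhds, self_mem_nhdsWithin] with x hx hx0
      have hx0' : 0 < ‖x ^ k‖ := norm_pos_iff.2 (pow_ne_zero _ hx0)
      rw [norm_mul, norm_mul] at hx
      refine le_of_mul_le_mul_left (hx.trans_eq ?_) hx0'
      ring
    have h3 : Tendsto (fun x : ℂ => C * ‖x ^ (m - k)‖) (𝓝[≠] 0) (𝓝 0) := by
      have : Continuous fun x : ℂ => C * ‖x ^ (m - k)‖ := by fun_prop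
      have h := this.tendsto 0
      rw [zero_pow (by omega), norm_zero, mul_zero] at h
      exact h.mono_left nhdsWithin_le_nhds
    have h4 : Tendsto (fun x => ‖g x‖) (𝓝[≠] 0) (𝓝 ‖g 0‖) :=
      (hg.continuousAt.norm.tendsto).mono_left nhdsWithin_le_nhds
    have := le_of_tendsto_of_tendsto h4 h3 h2
    exact hg0 (norm_le_zero_iff.1 this)
  · intro h
    obtain ⟨g, hg, hfg⟩ := (natCast_le_analyticOrderAt hf).1 h
    have h1 : (fun x : ℂ => x ^ m * g x) =O[𝓝 0] (fun x => x ^ m * (1 : ℂ)) :=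
      (isBigO_refl _ _).mul (hg.continuousAt.isBigO_one ℂ)
    refine h1.congr' ?_ (Eventually.of_forall fun x => by simp)
    filter_upwards [hfg] with x hx
    simp [hx]

theorem isBigO_comp_sub_comp {E : Type*} [NormedAddCommGroup E] [NormedSpace ℂ E]
    {G : E → ℂ} {p₀ : E} (hG : AnalyticAt ℂ G p₀) {p q : ℂ → E} (hp : Tendsto p (𝓝 0) (𝓝 p₀))
    (hq : Tendsto q (𝓝 0) (𝓝 p₀)) :
    (fun x => G (q x) - G (p x)) =O[𝓝 0] (fun x => q x - p x) := by
  obtain ⟨K, s, hs, hK⟩ := (hG.contDiffAt (n := 1)).exists_lipschitzOnWith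
  refine IsBigO.of_bound K ?_
  filter_upwards [hp hs, hq hs] with x hx hy
  have := hK.dist_le_mul _ hy _ hx
  rwa [dist_eq_norm, dist_eq_norm] at this

/-- Mean value inequality for `F` minus its linear part at `p x`, using that the derivative of `F`
is Lipschitz near `p₀`. -/
theorem isBigO_comp_sub_sub_fderiv {E : Type*} [NormedAddCommGroup E] [NormedSpace ℂ E]
    {F : E → ℂ} {p₀ : E} (hF : AnalyticAt ℂ F p₀) {p q : ℂ → E} (hp : Tendsto p (𝓝 0) (𝓝 p₀))
    (hq : Tendsto q (𝓝 0) (𝓝 p₀)) :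
    (fun x => F (q x) - F (p x) - fderiv ℂ F (p x) (q x - p x)) =O[𝓝 0]
      (fun x => ‖q x - p x‖ ^ 2) := by
  obtain ⟨K, s, hs, hK⟩ := (hF.fderiv.contDiffAt (n := 1)).exists_lipschitzOnWith
  obtain ⟨ε, hε, hball⟩ := Metric.mem_nhds_iff.1 (inter_mem hs hF.eventually_analyticAt)
  refine IsBigO.of_bound K ?_
  filter_upwards [hp (Metric.ball_mem_nhds p₀ hε), hq (Metric.ball_mem_nhds p₀ hε)] with x hp hq
  -- Intersecting with the ball about `p x` keeps `‖z - p x‖ ≤ ‖q x - p x‖`, so the derivative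
  -- varies by at most `K * ‖q x - p x‖`.
  have hconv : Convex ℝ (Metric.ball p₀ ε ∩ Metric.closedBall (p x) ‖q x - p x‖) :=
    (convex_ball _ _).inter (convex_closedBall _ _)
  refine (hconv.norm_image_sub_le_of_norm_hasFDerivWithin_le' (𝕜 := ℂ) (f' := fderiv ℂ F)
    (C := K * ‖q x - p x‖) (fun z hz => ?_) (fun z hz => ?_) ⟨hp, by simp⟩ ⟨hq, ?_⟩).trans_eq ?_
  · exact (hball hz.1).2.differentiableAt.hasFDerivAt.hasFDerivWithinAt
  · have h1 := hK.dist_le_mul z (hball hz.1).1 (p x) (hball hp).1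
    rw [dist_eq_norm, dist_eq_norm] at h1
    refine h1.trans ?_
    have : ‖z - p x‖ ≤ ‖q x - p x‖ := by simpa [dist_eq_norm] using hz.2
    gcongr
  · simp [dist_eq_norm]
  · rw [norm_pow, norm_norm]; ring

section

variable {n : ℕ} {Y : Fin (n + 1) → ℕ → ℂ → ℂ} {t : ℂ}

/-- The point `(x, Y)` with the series `Y i` truncated before degree `L`. -/
def truncation (Y : Fin (n + 1) → ℕ → ℂ → ℂ) (L : ℕ) (t x : ℂ) : ℂ × (Fin (n + 1) → ℂ) :=
  (x, fun i => ∑ j ∈ Finset.range L, Y i j t * x ^ j)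

theorem differentiable_truncation (L : ℕ) : Differentiable ℂ (truncation Y L t) := by
  unfold truncation
  fun_prop

theorem truncation_zero {L : ℕ} (hL : 0 < L) : truncation Y L t 0 = (0, fun i => Y i 0 t) := by
  refine Prod.ext rfl (funext fun i => ?_)
  simp only [truncation]
  rw [Finset.sum_eq_single 0]
  · simp
  · intro j _ hj
    simp [hj]
  · intro h
    exact absurd (Finset.mem_range.2 hL) h

theorem tendsto_truncation {L : ℕ} (hL : 0 < L) :
    Tendsto (truncation Y L t) (𝓝 0) (𝓝 (0, fun i => Y i 0 t)) := by
  rw [← truncation_zero hL]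
  exact (differentiable_truncation L).continuous.tendsto 0

theorem truncation_add (L m : ℕ) (x : ℂ) : truncation Y (L + m) t x = truncation Y L t x +
    (0, x ^ L • fun i => ∑ j ∈ Finset.range m, Y i (L + j) t * x ^ j) := by
  refine Prod.ext (by simp [truncation]) (funext fun i => ?_)
  simp only [truncation, Prod.snd_add, Pi.add_apply, Pi.smul_apply, smul_eq_mul]
  rw [Finset.sum_range_add, Finset.mul_sum]
  congr 1
  exact Finset.sum_congr rfl fun j _ => by rw [pow_add]; ring

theorem isBigO_truncation_add_sub (L m : ℕ) :
    (fun x => truncation Y (L + m) t x - truncation Y L t x) =O[𝓝 0] (fun x : ℂ => x ^ L) := by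
  simp only [truncation_add, add_sub_cancel_left]
  refine IsBigO.prod_left (by simpa using isBigO_zero _ _) ?_
  have hc : Continuous fun x : ℂ => fun i => ∑ j ∈ Finset.range m, Y i (L + j) t * x ^ j := by
    fun_prop
  have := (isBigO_refl (fun x : ℂ => x ^ L) (𝓝 0)).smul ((hc.tendsto 0).isBigO_one ℂ)
  simpa using this

theorem analyticAt_comp_truncation {G : ℂ × (Fin (n + 1) → ℂ) → ℂ}
    (hG : AnalyticAt ℂ G (0, fun i => Y i 0 t)) {L : ℕ} (hL : 0 < L) :
    AnalyticAt ℂ (fun x => G (truncation Y L t x)) 0 := by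
  have h := (differentiable_truncation (Y := Y) (t := t) L).analyticAt 0
  rw [← truncation_zero hL] at hG
  exact hG.comp h

/-- Lengthening the truncation beyond degree `k` changes the argument of `G`, hence its value, only
by `O(x ^ (k + 1))`. -/
theorem substCoeff_eq {G : ℂ × (Fin (n + 1) → ℂ) → ℂ} (hG : AnalyticAt ℂ G (0, fun i => Y i 0 t))
    {k L : ℕ} (hkL : k < L) : substCoeff G Y k t =
      iteratedDeriv k (fun x => G (truncation Y L t x)) 0 / k.factorial := by
  obtain ⟨m, rfl⟩ : ∃ m, L = k + 1 + m := ⟨L - (k + 1), by omega⟩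
  have h1 := analyticAt_comp_truncation hG (L := k + 1 + m) (by omega)
  have h2 := analyticAt_comp_truncation hG (L := k + 1) (by omega)
  have h3 := (isBigO_pow_iff_iteratedDeriv_eq_zero (h1.sub h2) (k + 1)).1
    ((isBigO_comp_sub_comp hG (tendsto_truncation (by omega)) (tendsto_truncation (by omega))).trans
      (isBigO_truncation_add_sub _ _)) k (by omega)
  rw [iteratedDeriv_sub h1.contDiffAt h2.contDiffAt, sub_eq_zero] at h3
  rw [h3]
  rfl

theorem iteratedDeriv_comp_truncation {G : ℂ × (Fin (n + 1) → ℂ) → ℂ}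
    (hG : AnalyticAt ℂ G (0, fun i => Y i 0 t)) {k L : ℕ} (hkL : k < L) :
    iteratedDeriv k (fun x => G (truncation Y L t x)) 0 = k.factorial * substCoeff G Y k t := by
  rw [substCoeff_eq hG hkL, mul_div_cancel₀ _ (Nat.cast_ne_zero.2 k.factorial_ne_zero)]

theorem isBigO_comp_truncation {F : ℂ × (Fin (n + 1) → ℂ) → ℂ}
    (hF : AnalyticAt ℂ F (0, fun i => Y i 0 t)) (hsol : ∀ k, substCoeff F Y k t = 0) {L : ℕ}
    (hL : 0 < L) : (fun x => F (truncation Y L t x)) =O[𝓝 0] (fun x => x ^ L) := by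
  refine (isBigO_pow_iff_iteratedDeriv_eq_zero (analyticAt_comp_truncation hF hL) L).2 fun k hk => ?_
  rw [iteratedDeriv_comp_truncation hF hk, hsol, mul_zero]

theorem isBigO_comp_truncation_sub {G : ℂ × (Fin (n + 1) → ℂ) → ℂ}
    (hG : AnalyticAt ℂ G (0, fun i => Y i 0 t)) {N : ℕ} {b : ℂ}
    (h0 : ∀ k < N, substCoeff G Y k t = 0) (hN : substCoeff G Y N t = b) {L : ℕ} (hL : N < L) :
    (fun x => G (truncation Y L t x) - b * x ^ N) =O[𝓝 0] (fun x => x ^ (N + 1)) := by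
  have h1 := analyticAt_comp_truncation hG (L := L) (by omega)
  have h2 : AnalyticAt ℂ (fun x : ℂ => b * x ^ N) 0 := by fun_prop
  refine (isBigO_pow_iff_iteratedDeriv_eq_zero (h1.sub h2) (N + 1)).2 fun k hk => ?_
  rw [iteratedDeriv_sub h1.contDiffAt h2.contDiffAt,
    iteratedDeriv_comp_truncation hG (by omega), iteratedDeriv_const_mul_field,
    iteratedDeriv_fun_pow_zero]
  rcases Nat.lt_succ_iff_lt_or_eq.1 hk with h | rfl
  · simp [h0 k h, h.ne]
  · simp [hN, mul_comm]

theorem fderiv_zero_prod_eq_sum (F : ℂ × (Fin (n + 1) → ℂ) → ℂ) (p : ℂ × (Fin (n + 1) → ℂ))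
    (h : Fin (n + 1) → ℂ) : fderiv ℂ F p (0, h) = ∑ i, partialY F i p * h i := by
  have : ((0 : ℂ), h) = ∑ i, h i • ((0 : ℂ), (Pi.single i 1 : Fin (n + 1) → ℂ)) := by
    refine Prod.ext (by simp [Prod.fst_sum]) ?_
    simp only [Prod.snd_sum, Prod.smul_snd]
    exact (pi_eq_sum_univ' h).trans (Finset.sum_congr rfl fun i _ => by
      congr 1)
  rw [this, map_sum]
  exact Finset.sum_congr rfl fun i _ => by rw [map_smul, smul_eq_mul, mul_comm]; rfl

theorem analyticAt_partialY {F : ℂ × (Fin (n + 1) → ℂ) → ℂ} {p : ℂ × (Fin (n + 1) → ℂ)}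
    (hF : AnalyticAt ℂ F p) (i : Fin (n + 1)) : AnalyticAt ℂ (partialY F i) p :=
  ((ContinuousLinearMap.apply ℂ ℂ ((0 : ℂ), (Pi.single i 1 : Fin (n + 1) → ℂ))).analyticAt
    _).comp hF.fderiv

theorem isBigO_comp_truncation_add_sub {F : ℂ × (Fin (n + 1) → ℂ) → ℂ}
    (hF : AnalyticAt ℂ F (0, fun i => Y i 0 t)) {L m : ℕ} (hL : 0 < L) (hm : 0 < m)
    {h : ℂ → Fin (n + 1) → ℂ} (hh : ContinuousAt h 0) :
    (fun x => F (truncation Y L t x + (0, x ^ m • h x)) - F (truncation Y L t x) -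
      x ^ m * ∑ i, partialY F i (truncation Y L t x) * h x i) =O[𝓝 0] (fun x => x ^ (2 * m)) := by
  have hq : Tendsto (fun x => truncation Y L t x + (0, x ^ m • h x)) (𝓝 0)
      (𝓝 (0, fun i => Y i 0 t)) := by
    have h1 : ContinuousAt (fun x : ℂ => ((0 : ℂ), x ^ m • h x)) 0 :=
      continuousAt_const.prodMk ((continuous_pow m).continuousAt.smul hh)
    have h2 := (tendsto_truncation (Y := Y) (t := t) hL).add h1.tendsto
    simpa [hm.ne'] using h2
  have h1 := isBigO_comp_sub_sub_fderiv hF (tendsto_truncation hL) hq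
  simp only [add_sub_cancel_left] at h1
  have h2 : (fun x : ℂ => ((0 : ℂ), x ^ m • h x)) =O[𝓝 0] (fun x : ℂ => x ^ m) := by
    refine IsBigO.prod_left (isBigO_zero _ _) ?_
    simpa using (isBigO_refl (fun x : ℂ => x ^ m) (𝓝 0)).smul (hh.tendsto.isBigO_one ℂ)
  refine (h1.trans (h2.norm_left.pow 2)).congr (fun x => ?_) (fun x => by rw [← pow_mul, mul_comm])
  rw [fderiv_zero_prod_eq_sum]
  simp only [Pi.smul_apply, smul_eq_mul, Finset.mul_sum]
  congr 1
  exact Finset.sum_congr rfl fun i _ => by ring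

/-- The leading term in `x` of `F(x, Φ_M + x ^ M y)`, where `Φ_M` is the truncation after
degree `M` of a formal solution. -/
theorem isBigO_leading_term {F : ℂ × (Fin (n + 1) → ℂ) → ℂ}
    (hF : AnalyticAt ℂ F (0, fun i => Y i 0 t)) (hsol : ∀ k, substCoeff F Y k t = 0) {N M : ℕ}
    {b : Fin (n + 1) → ℂ} (h0 : ∀ i, ∀ k < N, substCoeff (partialY F i) Y k t = 0)
    (hN : ∀ i, substCoeff (partialY F i) Y N t = b i) (hNM : N < M) (y : Fin (n + 1) → ℂ) :
    (fun x => F (truncation Y (M + 1) t x + (0, x ^ M • y)) - (∑ i, b i * y i) * x ^ (M + N))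
      =O[𝓝 0] (fun x => x ^ (M + N + 1)) := by
  have hpow : ∀ {a c : ℕ}, c ≤ a → (fun x : ℂ => x ^ a) =O[𝓝 0] (fun x : ℂ => x ^ c) := by
    intro a c h
    have h1 : (fun x : ℂ => x ^ (a - c)) =O[𝓝 0] (fun _ => (1 : ℂ)) :=
      (continuous_pow (a - c)).continuousAt.isBigO_one ℂ
    refine ((isBigO_refl (fun x : ℂ => x ^ c) (𝓝 0)).mul h1).congr (fun x => ?_) (fun x => ?_)
    · rw [← pow_add, Nat.add_sub_cancel' h]
    · rw [mul_one]
  have hpart : ∀ i, (fun x => partialY F i (truncation Y (M + 1) t x) - b i * x ^ N) =O[𝓝 0]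
      (fun x => x ^ (N + 1)) := fun i =>
    isBigO_comp_truncation_sub (analyticAt_partialY hF i) (h0 i) (hN i) (by omega)
  have hpartO : ∀ i, (fun x => partialY F i (truncation Y (M + 1) t x)) =O[𝓝 0]
      (fun x => x ^ N) := by
    intro i
    have h1 : (fun x => b i * x ^ N) =O[𝓝 0] (fun x : ℂ => x ^ N) :=
      (isBigO_refl _ _).const_mul_left _
    simpa using ((hpart i).trans (hpow (Nat.le_succ N))).add h1
  -- The short truncation does better than `O(x ^ (M + 1))`: adding `N` more terms makes `F` of
  -- order `M + 1 + N`, and these terms change `F` by `x ^ (M + 1)` times partial derivatives of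
  -- order `x ^ N`, up to a quadratic error.
  have hbase : (fun x => F (truncation Y (M + 1) t x)) =O[𝓝 0] (fun x => x ^ (M + N + 1)) := by
    have hc : Continuous fun x : ℂ => fun i : Fin (n + 1) =>
        ∑ j ∈ Finset.range N, Y i (M + 1 + j) t * x ^ j := by fun_prop
    have h1 := isBigO_comp_truncation_add_sub hF (L := M + 1) (m := M + 1) (by omega) (by omega)
      hc.continuousAt
    simp only [← truncation_add] at h1
    have h2 := isBigO_comp_truncation hF hsol (L := M + 1 + N) (by omega)
    have h3 : (fun x => x ^ (M + 1) * ∑ i, partialY F i (truncation Y (M + 1) t x) *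
        ∑ j ∈ Finset.range N, Y i (M + 1 + j) t * x ^ j) =O[𝓝 0]
        (fun x => x ^ (M + 1) * (x ^ N * 1)) := by
      refine (isBigO_refl _ _).mul (IsBigO.fun_sum fun i _ => (hpartO i).mul ?_)
      have hci : Continuous fun x : ℂ => ∑ j ∈ Finset.range N, Y i (M + 1 + j) t * x ^ j := by
        fun_prop
      exact (hci.tendsto 0).isBigO_one ℂ
    refine ((h2.trans (hpow (by omega))).sub ((h1.trans (hpow (by omega))).add
      (h3.congr_right (g₂ := fun x => x ^ (M + N + 1)) fun x => by ring))).congr_left fun x => ?_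
    ring
  -- The quadratic error `x ^ (2 * M)` is negligible because `N < M`.
  have h1 := (isBigO_comp_truncation_add_sub hF (L := M + 1) (m := M) (by omega) (by omega)
      (h := fun _ => y) continuousAt_const).trans
    (hpow (a := 2 * M) (c := M + N + 1) (by omega))
  have h2 : (fun x => x ^ M * ∑ i, (partialY F i (truncation Y (M + 1) t x) - b i * x ^ N) * y i)
      =O[𝓝 0] (fun x => x ^ M * (x ^ (N + 1) * 1)) :=
    (isBigO_refl _ _).mul (IsBigO.fun_sum fun i _ => (hpart i).mul (isBigO_const_const _ one_ne_zero _))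
  refine ((h1.add hbase).add
    (h2.congr_right (g₂ := fun x => x ^ (M + N + 1)) fun x => by ring)).congr_left fun x => ?_
  have h3 : ∑ i, (partialY F i (truncation Y (M + 1) t x) - b i * x ^ N) * y i =
      ∑ i, partialY F i (truncation Y (M + 1) t x) * y i - (∑ i, b i * y i) * x ^ N := by
    rw [Finset.sum_mul, ← Finset.sum_sub_distrib]
    exact Finset.sum_congr rfl fun i _ => by ring
  rw [h3]
  ring

end

/-! ### Uniform estimates over a compact set of `t` -/

theorem norm_le_mul_div_pow {f : ℂ → ℂ} {R C : ℝ} {m : ℕ}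
    (hd : DifferentiableOn ℂ f (Metric.ball 0 R)) (hC : ∀ x ∈ Metric.ball (0 : ℂ) R, ‖f x‖ ≤ C)
    (hO : f =O[𝓝 0] (fun x => x ^ (m + 1))) {x : ℂ} (hx : x ∈ Metric.ball (0 : ℂ) R) :
    ‖f x‖ ≤ C * (‖x‖ / R) ^ (m + 1) := by
  have hf0 : f 0 = 0 := (hO.norm_right.congr_right (g₂ := fun x : ℂ => ‖x - 0‖ ^ (m + 1))
    fun x => by simp).eq_zero_of_norm_pow (Nat.succ_ne_zero m)
  -- The higher-order Schwarz lemma takes vanishing of order `m + 1` in the form `o(|x| ^ m)`.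
  have ho : (f · - f 0) =o[𝓝 0] (fun w : ℂ => ‖w - 0‖ ^ m) := by
    simp only [hf0, sub_zero]
    have h1 : (fun x : ℂ => x ^ (m + 1)) =o[𝓝 0] (fun x : ℂ => x ^ m) :=
      isLittleO_pow_pow (Nat.lt_succ_self m)
    simpa using (hO.trans_isLittleO h1).norm_right
  have := Complex.dist_le_mul_div_pow_of_mapsTo_ball_of_isLittleO (R₂ := C) hd
    (fun z hz => by simpa [hf0] using hC z hz) ho hx
  simpa [hf0] using this

/-- Schwarz lemma on the ball of radius `3` about `y'`, which contains `y`: there `D - D y'` is at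
most `2 * c`, and `2 * c / 3 ≤ c`. -/
theorem norm_sub_le_of_norm_le_ball {E : Type*} [NormedAddCommGroup E] [NormedSpace ℂ E]
    {D : E → ℂ} {c : ℝ} (hD : DifferentiableOn ℂ D (Metric.ball 0 4))
    (hc : ∀ y ∈ Metric.ball (0 : E) 4, ‖D y‖ ≤ c) {y y' : E} (hy : ‖y‖ ≤ 1) (hy' : ‖y'‖ ≤ 1) :
    ‖D y - D y'‖ ≤ c * ‖y - y'‖ := by
  have hsub : Metric.ball y' 3 ⊆ Metric.ball (0 : E) 4 :=
    Metric.ball_subset_ball' (by rw [dist_zero_right]; linarith)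
  have hy'm : y' ∈ Metric.ball (0 : E) 4 := by simpa using by linarith
  have hc0 : 0 ≤ c := (norm_nonneg _).trans (hc y' hy'm)
  have h := Complex.dist_le_div_mul_dist_of_mapsTo_ball (R₂ := 2 * c) (hD.mono hsub)
    (fun z hz => by
      rw [Metric.mem_closedBall, dist_eq_norm]
      linarith [norm_sub_le (D z) (D y'), hc z (hsub hz), hc y' hy'm])
    (z := y) (by rw [Metric.mem_ball, dist_eq_norm]; linarith [norm_sub_le y y'])
  rw [dist_eq_norm, dist_eq_norm] at h
  refine h.trans (mul_le_mul_of_nonneg_right ?_ (norm_nonneg _))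
  linarith

section

variable {n : ℕ} {Y : Fin (n + 1) → ℕ → ℂ → ℂ} {A : Set ℂ} {Δ : Set (ℂ × (Fin (n + 1) → ℂ))}
  {F : ℂ × (Fin (n + 1) → ℂ) → ℂ}

theorem continuousAt_truncation_add {t : ℂ} (hY : ∀ i j, ContinuousAt (Y i j) t) (L M : ℕ)
    (x : ℂ) (y : Fin (n + 1) → ℂ) :
    ContinuousAt (fun q : ℂ × ℂ × (Fin (n + 1) → ℂ) =>
      truncation Y L q.2.1 q.1 + (0, q.1 ^ M • q.2.2)) (x, t, y) := by
  unfold truncation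
  refine ContinuousAt.add (ContinuousAt.prodMk continuousAt_fst (continuousAt_pi.2 fun i => ?_))
    (by fun_prop)
  refine tendsto_finsetSum _ fun j _ => ?_
  have h1 : ContinuousAt (fun q : ℂ × ℂ × (Fin (n + 1) → ℂ) => Y i j q.2.1) (x, t, y) :=
    ContinuousAt.comp (f := fun q : ℂ × ℂ × (Fin (n + 1) → ℂ) => q.2.1) (g := Y i j) (hY i j)
      (by fun_prop)
  exact h1.mul (by fun_prop)

/-- At `x = 0` the point lies in `Δ` for all `(t, y)`, so compactness in `(t, y)` gives one radius
in `x` that works for all of them. -/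
theorem exists_radius_bound (hA : IsCompact A) (hΔ : IsOpen Δ) (hF : ContinuousOn F Δ)
    (hY : ∀ t ∈ A, ∀ i j, ContinuousAt (Y i j) t) (h0 : ∀ t ∈ A, (0, fun i => Y i 0 t) ∈ Δ)
    {L M : ℕ} (hL : 0 < L) (hM : 0 < M) (r₀ : ℝ) :
    ∃ R C : ℝ, 0 < R ∧ R ≤ 1 ∧ 0 ≤ C ∧ ∀ x ∈ Metric.closedBall (0 : ℂ) R, ∀ t ∈ A,
      ∀ y ∈ Metric.closedBall (0 : Fin (n + 1) → ℂ) r₀,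
        truncation Y L t x + (0, x ^ M • y) ∈ Δ ∧ ‖F (truncation Y L t x + (0, x ^ M • y))‖ ≤ C := by
  have hK : IsCompact (A ×ˢ Metric.closedBall (0 : Fin (n + 1) → ℂ) r₀) :=
    hA.prod (isCompact_closedBall _ _)
  have hev : ∀ᶠ x in 𝓝 (0 : ℂ), ∀ q ∈ A ×ˢ Metric.closedBall (0 : Fin (n + 1) → ℂ) r₀,
      truncation Y L q.1 x + (0, x ^ M • q.2) ∈ Δ := by
    refine hK.eventually_forall_of_forall_eventually fun q hq => ?_
    refine (continuousAt_truncation_add (hY q.1 hq.1) L M 0 q.2).eventually_mem (hΔ.mem_nhds ?_)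
    simpa [truncation_zero hL, hM.ne'] using h0 q.1 hq.1
  obtain ⟨R, hR, hball⟩ := Metric.nhds_basis_closedBall.mem_iff.1 hev
  have hR' : Metric.closedBall (0 : ℂ) (min R 1) ⊆ Metric.closedBall 0 R :=
    Metric.closedBall_subset_closedBall (min_le_left _ _)
  obtain ⟨C, hC⟩ := ((isCompact_closedBall (0 : ℂ) (min R 1)).prod hK).exists_bound_of_continuousOn
    (f := fun q => F (truncation Y L q.2.1 q.1 + (0, q.1 ^ M • q.2.2)))
    (hF.comp (fun q hq => (continuousAt_truncation_add (hY q.2.1 hq.2.1) L M q.1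
      q.2.2).continuousWithinAt) (fun q hq => hball (hR' hq.1) q.2 hq.2))
  exact ⟨min R 1, max C 0, lt_min hR one_pos, min_le_right _ _, le_max_right _ _,
    fun x hx t ht y hy => ⟨hball (hR' hx) (t, y) ⟨ht, hy⟩,
      (hC (x, t, y) ⟨hx, ht, hy⟩).trans (le_max_left _ _)⟩⟩

theorem differentiableAt_truncation_add {t x : ℂ} (L M : ℕ) {y : ℂ → Fin (n + 1) → ℂ}
    (hy : DifferentiableAt ℂ y x) :
    DifferentiableAt ℂ (fun x => truncation Y L t x + (0, x ^ M • y x)) x := by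
  refine (differentiable_truncation L x).add (DifferentiableAt.prodMk (by fun_prop) ?_)
  exact (differentiable_pow M x).smul hy

theorem exists_norm_comp_truncation_le (hA : IsCompact A) (hΔ : IsOpen Δ)
    (hF : AnalyticOnNhd ℂ F Δ) (hY : ∀ t ∈ A, ∀ i j, ContinuousAt (Y i j) t)
    (h0 : ∀ t ∈ A, (0, fun i => Y i 0 t) ∈ Δ) (hsol : ∀ t ∈ A, ∀ k, substCoeff F Y k t = 0)
    (L : ℕ) : ∃ R C : ℝ, 0 < R ∧ R ≤ 1 ∧ 0 ≤ C ∧ ∀ x ∈ Metric.ball (0 : ℂ) R, ∀ t ∈ A,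
      ‖F (truncation Y (L + 1) t x)‖ ≤ C * ‖x‖ ^ (L + 1) := by
  obtain ⟨R, C, hR, hR1, hC, h⟩ := exists_radius_bound hA hΔ hF.continuousOn hY h0 (L := L + 1)
    (M := 1) (by omega) one_pos 0
  have h' : ∀ x ∈ Metric.ball (0 : ℂ) R, ∀ t ∈ A, truncation Y (L + 1) t x ∈ Δ ∧
      ‖F (truncation Y (L + 1) t x)‖ ≤ C := by
    intro x hx t ht
    simpa [Prod.mk_zero_zero] using h x (Metric.ball_subset_closedBall hx) t ht 0 (by simp)
  refine ⟨R, C / R ^ (L + 1), hR, hR1, by positivity, fun x hx t ht => ?_⟩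
  refine (norm_le_mul_div_pow (f := fun x => F (truncation Y (L + 1) t x)) (R := R) ?_
    (fun x hx => (h' x hx t ht).2) (isBigO_comp_truncation (hF _ (h0 t ht)) (hsol t ht)
      (Nat.succ_pos L)) hx).trans_eq ?_
  · intro x hx
    exact ((hF _ (h' x hx t ht).1).differentiableAt.comp x
      (differentiable_truncation _ x)).differentiableWithinAt
  · rw [div_pow]; ring

/-- The expansion of `F` holds for each `(t, y)` separately, with an uncontrolled constant. The
Schwarz lemma in `x` makes it uniform, since its constant depends only on the supremum over a common
disc. -/
theorem exists_norm_remainder_le (hA : IsCompact A) (hΔ : IsOpen Δ)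
    (hF : AnalyticOnNhd ℂ F Δ) (hY : ∀ t ∈ A, ∀ i j, ContinuousAt (Y i j) t)
    (h0 : ∀ t ∈ A, (0, fun i => Y i 0 t) ∈ Δ) (hsol : ∀ t ∈ A, ∀ k, substCoeff F Y k t = 0)
    {N M : ℕ} (hNM : N < M) {b : Fin (n + 1) → ℂ → ℂ} (hb : ∀ i, ContinuousOn (b i) A)
    (hb0 : ∀ t ∈ A, ∀ i, ∀ k < N, substCoeff (partialY F i) Y k t = 0)
    (hbN : ∀ t ∈ A, ∀ i, substCoeff (partialY F i) Y N t = b i t) :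
    ∃ R C : ℝ, 0 < R ∧ 0 ≤ C ∧ ∀ x ∈ puncturedDisc R, ∀ t ∈ A,
      ∀ y ∈ Metric.ball (0 : Fin (n + 1) → ℂ) 4,
        truncation Y (M + 1) t x + (0, x ^ M • y) ∈ Δ ∧
        ‖F (truncation Y (M + 1) t x + (0, x ^ M • y)) / x ^ (M + N) - ∑ i, b i t * y i‖
          ≤ C * ‖x‖ := by
  obtain ⟨R, C, hR, hR1, hC, h⟩ := exists_radius_bound hA hΔ hF.continuousOn hY h0 (L := M + 1)
    (M := M) (by omega) (by omega) 4
  choose β hβ using fun i => hA.exists_bound_of_continuousOn (hb i)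
  set S := ∑ i, |β i| * 4 with hS
  have hS0 : 0 ≤ S := Finset.sum_nonneg fun i _ => by positivity
  -- `C` bounds `F` and `S` bounds the subtracted leading term, as `‖y i‖ ≤ 4` and `‖x‖ ≤ 1`.
  refine ⟨R, (C + S) / R ^ (M + N + 1), hR, by positivity, fun x hx t ht y hy => ?_⟩
  have hy' := Metric.ball_subset_closedBall hy
  have hxb : x ∈ Metric.ball (0 : ℂ) R := by simpa using hx.2
  refine ⟨(h x (Metric.ball_subset_closedBall hxb) t ht y hy').1, ?_⟩
  have hsum : ‖∑ i, b i t * y i‖ ≤ S := by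
    refine norm_sum_le_of_le _ fun i _ => ?_
    rw [norm_mul]
    have h1 : ‖y i‖ ≤ 4 := (norm_le_pi_norm y i).trans (by simpa using hy')
    have h2 : ‖b i t‖ ≤ |β i| := (hβ i t ht).trans (le_abs_self _)
    gcongr
  have hx0 : x ≠ 0 := norm_pos_iff.1 hx.1
  have key := norm_le_mul_div_pow (R := R) (C := C + S) (m := M + N)
    (f := fun x => F (truncation Y (M + 1) t x + (0, x ^ M • y)) -
      (∑ i, b i t * y i) * x ^ (M + N)) ?_ ?_
    (isBigO_leading_term (hF _ (h0 t ht)) (hsol t ht) (hb0 t ht) (hbN t ht) hNM y) hxb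
  · have h3 : F (truncation Y (M + 1) t x + (0, x ^ M • y)) / x ^ (M + N) - ∑ i, b i t * y i =
        (F (truncation Y (M + 1) t x + (0, x ^ M • y)) -
          (∑ i, b i t * y i) * x ^ (M + N)) / x ^ (M + N) := by
      field_simp
    rw [h3, norm_div, div_le_iff₀ (norm_pos_iff.2 (pow_ne_zero _ hx0))]
    refine key.trans_eq ?_
    rw [norm_pow, div_pow]
    ring
  · intro x hx
    refine DifferentiableAt.differentiableWithinAt (DifferentiableAt.sub ?_ (by fun_prop))
    exact (hF _ (h x (Metric.ball_subset_closedBall hx) t ht y hy').1).differentiableAt.comp x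
      (differentiableAt_truncation_add _ _ (differentiableAt_const y))
  · intro x hx
    have hx1 : ‖x‖ ≤ 1 := by
      have : ‖x‖ < R := by simpa using hx
      linarith
    refine (norm_sub_le _ _).trans (add_le_add
      (h x (Metric.ball_subset_closedBall hx) t ht y hy').2 ?_)
    rw [norm_mul, norm_pow]
    exact (mul_le_of_le_one_right (norm_nonneg _) (pow_le_one₀ (norm_nonneg _) hx1)).trans hsum

/-- The fixed-point form of the equation `F(x, Φ_M + x ^ M y) = 0` near a formal solution. -/
def fixedPointMap (F : ℂ × (Fin (n + 1) → ℂ) → ℂ) (Y : Fin (n + 1) → ℕ → ℂ → ℂ) (M N : ℕ)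
    (b : ℂ → ℂ) (x t : ℂ) (y : Fin (n + 1) → ℂ) : ℂ :=
  y (Fin.last n) - F (truncation Y (M + 1) t x + (0, x ^ M • y)) / x ^ (M + N) / b t

/-- The Lipschitz constant `1 / 2` splits into two quarters: the linear terms with `i < n`, made
small by `M`, and the remainder `O(x)`, made small by `s`. The order of choice matters, because the
remainder constant depends on `M`. -/
theorem exists_isContractive (hA : IsCompact A) (hΔ : IsOpen Δ)
    (hF : AnalyticOnNhd ℂ F Δ) (hY : ∀ t ∈ A, ∀ i j, ContinuousAt (Y i j) t)
    (h0 : ∀ t ∈ A, (0, fun i => Y i 0 t) ∈ Δ) (hsol : ∀ t ∈ A, ∀ k, substCoeff F Y k t = 0)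
    {N : ℕ} {b : Fin (n + 1) → ℂ → ℂ} (hb : ∀ i, ContinuousOn (b i) A)
    (hb0 : ∀ t ∈ A, ∀ i, ∀ k < N, substCoeff (partialY F i) Y k t = 0)
    (hbN : ∀ t ∈ A, ∀ i, substCoeff (partialY F i) Y N t = b i t)
    (hbn : ∀ t ∈ A, b (Fin.last n) t ≠ 0) :
    ∃ M : ℕ, 0 < M ∧ ∃ s : ℝ, 0 < s ∧
      IsContractive M A s (fixedPointMap F Y M N (b (Fin.last n))) := by
  choose β hβ using fun i => hA.exists_bound_of_continuousOn ((hb i).div (hb (Fin.last n)) hbn)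
  obtain ⟨γ, hγ⟩ := hA.exists_bound_of_continuousOn ((hb (Fin.last n)).inv₀ hbn)
  -- `M > N` is required for the leading term; the other bound makes `∑ |β i| * (E / M)` at most `E
  -- / 4`.
  obtain ⟨M, hM⟩ := exists_nat_gt (max (N : ℝ) (4 * ∑ i, |β i|))
  have hNM : N < M := by exact_mod_cast (le_max_left _ _).trans_lt hM
  have hβM : 4 * ∑ i, |β i| < M := (le_max_right _ _).trans_lt hM
  have hM0 : 0 < M := by omega
  have hM0' : (0 : ℝ) < M := by exact_mod_cast hM0
  obtain ⟨R, C, hR, hC, h⟩ := exists_norm_remainder_le hA hΔ hF hY h0 hsol hNM hb hb0 hbN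
  have hγC : 0 < 4 * (|γ| * C) + 1 := by positivity
  -- With this `s` the remainder divided by the last `b` is at most `1 / 4`; the `+ 1` avoids a zero
  -- denominator.
  set s := min R (1 / (4 * (|γ| * C) + 1)) with hs
  have hsR : ∀ x ∈ puncturedDisc s, x ∈ puncturedDisc R := fun x hx =>
    ⟨hx.1, hx.2.trans_le (min_le_left _ _)⟩
  have hsmall : ∀ x ∈ puncturedDisc s, |γ| * (C * ‖x‖) ≤ 1 / 4 := by
    intro x hx
    have h1 : ‖x‖ < 1 / (4 * (|γ| * C) + 1) := hx.2.trans_le (min_le_right _ _)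
    rw [lt_div_iff₀ hγC] at h1
    nlinarith [hx.1]
  have hlast : ∀ t ∈ A, ‖(b (Fin.last n) t)⁻¹‖ ≤ |γ| := fun t ht => (hγ t ht).trans (le_abs_self _)
  have hmem1 : ∀ y : Fin (n + 1) → ℂ, ‖y‖ ≤ 1 → y ∈ Metric.ball (0 : Fin (n + 1) → ℂ) 4 := by
    intro y hy
    simpa using by linarith
  refine ⟨M, hM0, s, lt_min hR (by positivity), ?_, ?_, ?_, ?_⟩
  · unfold fixedPointMap
    refine ContinuousOn.sub (by fun_prop) (ContinuousOn.div (ContinuousOn.div ?_ (by fun_prop) ?_)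
      ?_ ?_)
    · refine hF.continuousOn.comp (fun q hq => (continuousAt_truncation_add (hY q.2.1 hq.2.1) _ M
        q.1 q.2.2).continuousWithinAt) fun q hq => ?_
      exact (h q.1 (hsR _ hq.1) q.2.1 hq.2.1 q.2.2 (hmem1 _ (by simpa using hq.2.2))).1
    · exact fun q hq => pow_ne_zero _ (norm_pos_iff.1 hq.1.1)
    · exact (hb (Fin.last n)).comp (by fun_prop) fun q hq => hq.2.1
    · exact fun q hq => hbn _ hq.2.1
  · intro t ht x hx y hy hy1
    unfold fixedPointMap
    have hFx : DifferentiableAt ℂ (fun x => F (truncation Y (M + 1) t x + (0, x ^ M • y x))) x :=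
      DifferentiableAt.comp (f := fun x => truncation Y (M + 1) t x + (0, x ^ M • y x)) x
        (hF _ (h x (hsR x hx) t ht _ (hmem1 _ hy1)).1).differentiableAt
        (differentiableAt_truncation_add _ _ hy)
    exact (differentiableAt_pi.1 hy _).sub
      ((hFx.div (differentiable_pow (M + N) x) (pow_ne_zero _ (norm_pos_iff.1 hx.1))).div_const _)
  · intro x hx t ht
    have h1 := (h x (hsR x hx) t ht 0 (by simp)).2
    simp only [Pi.zero_apply, mul_zero, Finset.sum_const_zero, sub_zero] at h1
    simp only [fixedPointMap, Pi.zero_apply, zero_sub, norm_neg]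
    rw [div_eq_mul_inv _ (b _ t), norm_mul]
    have h2 := hsmall x hx
    have h3 := mul_le_mul h1 (hlast t ht) (norm_nonneg _) (by positivity)
    linarith
  · intro x hx t ht y y' hy hy' E hE hE'
    set D : (Fin (n + 1) → ℂ) → ℂ := fun y =>
      F (truncation Y (M + 1) t x + (0, x ^ M • y)) / x ^ (M + N) - ∑ i, b i t * y i with hD
    have hE0 : 0 ≤ E := (norm_nonneg _).trans (hE (Fin.last n))
    have hDd : DifferentiableOn ℂ D (Metric.ball 0 4) := by
      intro y hy
      simp only [hD, div_eq_mul_inv]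
      refine DifferentiableAt.differentiableWithinAt
        (DifferentiableAt.sub (DifferentiableAt.mul_const ?_ _) (by fun_prop))
      exact DifferentiableAt.comp (f := fun y => truncation Y (M + 1) t x + (0, x ^ M • y)) y
        (hF _ (h x (hsR x hx) t ht _ hy).1).differentiableAt (by fun_prop)
    have hlip := norm_sub_le_of_norm_le_ball hDd (fun y hy => (h x (hsR x hx) t ht y hy).2) hy hy'
    have hyy : ‖y - y'‖ ≤ E := (pi_norm_le_iff_of_nonneg hE0).2 hE
    -- The term of index `n` in the linear part, divided by its own coefficient, cancels the entry
    -- `y (Fin.last n)`.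
    have hdecomp : ∀ y : Fin (n + 1) → ℂ, fixedPointMap F Y M N (b (Fin.last n)) x t y =
        -∑ i ∈ Finset.univ.erase (Fin.last n), b i t / b (Fin.last n) t * y i -
          D y * (b (Fin.last n) t)⁻¹ := by
      intro y
      have hb' := hbn t ht
      have h1 : F (truncation Y (M + 1) t x + (0, x ^ M • y)) / x ^ (M + N) =
          D y + ∑ i, b i t * y i := by simp [hD]
      have h2 : (∑ i, b i t * y i) / b (Fin.last n) t = y (Fin.last n) +
          ∑ i ∈ Finset.univ.erase (Fin.last n), b i t / b (Fin.last n) t * y i := by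
        rw [Finset.sum_div, ← Finset.add_sum_erase _ _ (Finset.mem_univ (Fin.last n))]
        congr 1
        · field_simp
        · exact Finset.sum_congr rfl fun i _ => by ring
      simp only [fixedPointMap]
      rw [h1, add_div, h2]
      ring
    have hdiff : fixedPointMap F Y M N (b (Fin.last n)) x t y -
        fixedPointMap F Y M N (b (Fin.last n)) x t y' =
        -(∑ i ∈ Finset.univ.erase (Fin.last n), b i t / b (Fin.last n) t * (y i - y' i)) -
          (D y - D y') * (b (Fin.last n) t)⁻¹ := by
      rw [hdecomp, hdecomp]
      simp only [mul_sub, Finset.sum_sub_distrib]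
      ring
    have hs1 : ‖∑ i ∈ Finset.univ.erase (Fin.last n), b i t / b (Fin.last n) t * (y i - y' i)‖ ≤
        E / 4 := by
      have h1 : ‖∑ i ∈ Finset.univ.erase (Fin.last n), b i t / b (Fin.last n) t * (y i - y' i)‖ ≤
          ∑ i ∈ Finset.univ.erase (Fin.last n), |β i| * (E / M) := by
        refine norm_sum_le_of_le _ fun i hi => ?_
        rw [norm_mul]
        exact mul_le_mul ((hβ i t ht).trans (le_abs_self _)) (hE' i (Finset.ne_of_mem_erase hi))
          (norm_nonneg _) (abs_nonneg _)
      have h2 : ∑ i ∈ Finset.univ.erase (Fin.last n), |β i| * (E / M) ≤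
          ∑ i, |β i| * (E / M) :=
        Finset.sum_le_sum_of_subset_of_nonneg (Finset.erase_subset _ _) fun i _ _ => by positivity
      refine (h1.trans h2).trans ?_
      rw [← Finset.sum_mul, mul_div_assoc', div_le_div_iff₀ hM0' (by norm_num)]
      nlinarith
    have hs2 : ‖(D y - D y') * (b (Fin.last n) t)⁻¹‖ ≤ E / 4 := by
      rw [norm_mul]
      have h1 : ‖D y - D y'‖ ≤ C * ‖x‖ * E := hlip.trans (by gcongr)
      have h2 := mul_le_mul h1 (hlast t ht) (norm_nonneg _) (by positivity)
      have h3 := mul_le_mul_of_nonneg_right (hsmall x hx) hE0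
      linarith
    rw [hdiff]
    refine (norm_sub_le _ _).trans ?_
    rw [norm_neg]
    linarith

end

/-! ### Formal solutions as approximate fixed points -/

theorem isOpen_polydisc {n : ℕ} (ρ : ℝ) (ε : Fin (n + 1) → ℝ≥0∞) : IsOpen (polydisc ρ ε) := by
  have : polydisc ρ ε = {p | ‖p.1‖ < ρ} ∩ ⋂ j, {p | ‖p.2 j‖ₑ < ε j} := by
    ext p; simp [polydisc]
  rw [this]
  exact (isOpen_lt (by fun_prop) continuous_const).inter
    (isOpen_iInter_of_finite fun j => isOpen_lt (by fun_prop) continuous_const)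

theorem differentiableOn_iterate_delta {r η : ℝ} {α : ℕ → ℂ → ℂ}
    (hα : ∀ k, DifferentiableOn ℂ (α k) (puncturedDisc r)) (i k : ℕ) :
    DifferentiableOn ℂ ((delta η)^[i] α k) (puncturedDisc r) := by
  induction i generalizing k with
  | zero => exact hα k
  | succ i ih =>
    rw [Function.iterate_succ_apply']
    exact ((ih k).const_mul _).add (DifferentiableOn.mul (by fun_prop)
      ((ih k).deriv (isOpen_puncturedDisc r)))

/-- The sums start at degree `1`, whence the factor `ρ`, which lets them enter the unit ball on a
small disc. -/
theorem exists_admissible_sum {A : Set ℂ} (hA : IsCompact A) {c : ℕ → ℂ → ℂ}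
    (hc : ∀ j, ContinuousOn (c j) A) (L : ℕ) :
    ∃ C : ℝ, 0 ≤ C ∧ ∀ ρ ≤ 1, Admissible A ρ (C * ρ)
      (fun x t => ∑ j ∈ Finset.range L, c j t * x ^ (j + 1)) := by
  choose β hβ using fun j => hA.exists_bound_of_continuousOn (hc j)
  refine ⟨∑ j ∈ Finset.range L, |β j|, Finset.sum_nonneg fun _ _ => abs_nonneg _, fun ρ hρ => ?_⟩
  refine ⟨?_, fun t ht => by fun_prop, fun x hx t ht => ?_⟩
  · refine continuousOn_finsetSum _ fun j _ => ContinuousOn.mul ?_ (by fun_prop)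
    exact (hc j).comp continuousOn_snd fun p hp => hp.2
  · rw [Finset.sum_mul]
    refine norm_sum_le_of_le _ fun j _ => ?_
    rw [norm_mul, norm_pow, pow_succ']
    have h1 : ‖c j t‖ ≤ |β j| := (hβ j t ht).trans (le_abs_self _)
    have h2 : ‖x‖ * ‖x‖ ^ j ≤ ρ :=
      (mul_le_of_le_one_right (norm_nonneg _)
        (pow_le_one₀ (norm_nonneg _) (hx.2.le.trans hρ))).trans hx.2.le
    gcongr

theorem hasDerivAt_flow_term {η : ℝ} {c : ℂ → ℂ} {x t : ℂ} {M j : ℕ} {u : ℝ}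
    (hc : DifferentiableAt ℂ c (Complex.exp (-(Complex.I * η * u)) * t)) :
    HasDerivAt (fun u : ℝ => -(Complex.exp (-(M * u : ℝ)) *
        (c (Complex.exp (-(Complex.I * η * u)) * t) * (Complex.exp (-u) * x) ^ (j + 1))))
      (Complex.exp (-(M * u : ℝ)) *
        (((M + 1 + j : ℕ) * c (Complex.exp (-(Complex.I * η * u)) * t) + Complex.I * η *
          (Complex.exp (-(Complex.I * η * u)) * t) *
            deriv c (Complex.exp (-(Complex.I * η * u)) * t)) *
          (Complex.exp (-u) * x) ^ (j + 1))) u := by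
  have hu : HasDerivAt (fun u : ℝ => (u : ℂ)) 1 u := Complex.ofRealCLM.hasDerivAt
  have h1 : HasDerivAt (fun u : ℝ => Complex.exp (-(M * u : ℝ)))
      (Complex.exp (-(M * u : ℝ)) * (-(M * 1))) u := by
    have := ((hu.const_mul (M : ℂ)).neg).cexp
    simpa using this
  have h2 : HasDerivAt (fun u : ℝ => Complex.exp (-(Complex.I * η * u)) * t)
      (Complex.exp (-(Complex.I * η * u)) * (-(Complex.I * η * 1)) * t) u :=
    ((hu.const_mul (Complex.I * η)).neg).cexp.mul_const t
  have h3 := hc.hasDerivAt.comp u h2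
  have h4 : HasDerivAt (fun u : ℝ => Complex.exp (-u) * x) (Complex.exp (-u) * (-1) * x) u :=
    hu.neg.cexp.mul_const x
  have h5 := h4.pow (j + 1)
  have h6 := (h1.mul (h3.mul h5)).neg
  refine h6.congr_deriv ?_
  simp only [Function.comp_apply, Pi.mul_apply, Pi.pow_apply, Nat.add_sub_cancel]
  push_cast
  ring

section

variable {A : Set ℂ} {r η : ℝ} {α : ℕ → ℂ → ℂ}

/-- On a term of degree `j + 1` the operator `M + δ` acts as `δ` does on the term of degree `M + 1 +
j` of the original series, so both produce the same coefficient. -/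
theorem flowInt_sum_iterate_delta (hA : IsCompact A) (hrot : RotInvariant A)
    (hAr : A ⊆ puncturedDisc r) (hα : ∀ k, DifferentiableOn ℂ (α k) (puncturedDisc r)) {M : ℕ}
    (hM : 0 < M) (i L : ℕ) {ρ : ℝ} (hρ : ρ ≤ 1) {x t : ℂ} (hx : x ∈ puncturedDisc ρ)
    (ht : t ∈ A) :
    flowInt M η (fun x t => ∑ j ∈ Finset.range L,
      (delta η)^[i + 1] α (M + 1 + j) t * x ^ (j + 1)) x t =
      ∑ j ∈ Finset.range L, (delta η)^[i] α (M + 1 + j) t * x ^ (j + 1) := by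
  have hcont : ∀ i k, ContinuousOn ((delta η)^[i] α k) A := fun i k =>
    (differentiableOn_iterate_delta hα i k).continuousOn.mono hAr
  obtain ⟨C, -, hC⟩ := exists_admissible_sum hA (fun j => hcont (i + 1) (M + 1 + j)) L
  obtain ⟨C', -, hC'⟩ := exists_admissible_sum hA (fun j => hcont i (M + 1 + j)) L
  refine flowInt_eq_of_hasDerivAt (w := fun x t => ∑ j ∈ Finset.range L,
    (delta η)^[i] α (M + 1 + j) t * x ^ (j + 1)) hrot hM (hC ρ hρ) (hC' ρ hρ) hx ht fun u _ => ?_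
  simp only [Finset.mul_sum, ← Finset.sum_neg_distrib, Function.iterate_succ_apply']
  refine HasDerivAt.fun_sum fun j _ => ?_
  exact hasDerivAt_flow_term ((differentiableOn_iterate_delta hα i (M + 1 + j)).differentiableAt
    ((isOpen_puncturedDisc r).mem_nhds (hAr (hrot.exp_mul_mem ht η u))))

/-- The coefficients of a formal solution grow at most geometrically, uniformly on each compact
rotation invariant set where `∂F/∂y_n` has a non-vanishing leading coefficient. -/
theorem exists_norm_coeff_le {n N : ℕ} {Δ : Set (ℂ × (Fin (n + 1) → ℂ))}
    {F : ℂ × (Fin (n + 1) → ℂ) → ℂ} (hΔ : IsOpen Δ) (hF : AnalyticOnNhd ℂ F Δ)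
    (hA : IsCompact A) (hrot : RotInvariant A) (hAr : A ⊆ puncturedDisc r)
    (hα : ∀ k, DifferentiableOn ℂ (α k) (puncturedDisc r))
    (h0 : ∀ t ∈ A, ((0 : ℂ), fun i => jet n η α i 0 t) ∈ Δ)
    (hsol : ∀ t ∈ A, ∀ k, substCoeff F (jet n η α) k t = 0)
    {b : Fin (n + 1) → ℂ → ℂ} (hb : ∀ i, ContinuousOn (b i) A)
    (hb0 : ∀ t ∈ A, ∀ i, ∀ k < N, substCoeff (partialY F i) (jet n η α) k t = 0)
    (hbN : ∀ t ∈ A, ∀ i, substCoeff (partialY F i) (jet n η α) N t = b i t)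
    (hbn : ∀ t ∈ A, b (Fin.last n) t ≠ 0) :
    ∃ (M : ℕ) (s : ℝ), 0 < s ∧ ∀ t ∈ A, ∀ k, ‖α (M + 1 + k) t‖ ≤ (2 / s) ^ (k + 1) := by
  have hY : ∀ t ∈ A, ∀ i j, ContinuousAt (jet n η α i j) t := fun t ht i j =>
    ((differentiableOn_iterate_delta hα i j).differentiableAt
      ((isOpen_puncturedDisc r).mem_nhds (hAr ht))).continuousAt
  obtain ⟨M, hM, s, hs, hΨ⟩ := exists_isContractive hA hΔ hF hY h0 hsol hb hb0 hbN hbn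
  refine ⟨M, s, hs, fun t ht k => hΨ.norm_coeff_le hrot hM hs (η := η)
    (fun i k => (delta η)^[i] α (M + 1 + k)) (fun k => ?_) ht k⟩
  -- With `k + 1 + N` terms kept after degree `M`, `F` is of order `M + N + k + 2`; dividing by `x ^
  -- (M + N)` leaves the required `k + 2`.
  obtain ⟨R, C, hR, hR1, hC, hbound⟩ :=
    exists_norm_comp_truncation_le hA hΔ hF hY h0 hsol (M + (k + 1 + N))
  obtain ⟨γ, hγ⟩ := hA.exists_bound_of_continuousOn ((hb (Fin.last n)).inv₀ hbn)
  obtain ⟨C', hC', hadm⟩ := exists_admissible_sum hA (c := fun j => (delta η)^[n] α (M + 1 + j))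
    (fun j => (differentiableOn_iterate_delta hα n _).continuousOn.mono hAr) (k + 1 + N)
  set ρ := min R (1 / (C' + 1)) with hρ
  have hρ1 : ρ ≤ 1 := (min_le_left _ _).trans hR1
  refine ⟨k + 1 + N, by omega, C * |γ|, ρ, lt_min hR (by positivity), by positivity, ?_,
    fun i _ x hx t ht => flowInt_sum_iterate_delta hA hrot hAr hα hM i _ hρ1 hx ht, ?_⟩
  · refine (hadm ρ hρ1).of_bound fun x hx t ht => ((hadm ρ hρ1).bound x hx t ht).trans ?_
    have h1 : ρ ≤ 1 / (C' + 1) := min_le_right _ _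
    calc C' * ρ ≤ C' * (1 / (C' + 1)) := by gcongr
      _ ≤ 1 := by rw [mul_one_div, div_le_one (by positivity)]; linarith
  · intro x hx t ht
    have hx0 : 0 < ‖x‖ := hx.1
    have htr : truncation (jet n η α) (M + 1) t x + (0, x ^ M • fun i : Fin (n + 1) =>
        ∑ j ∈ Finset.range (k + 1 + N), (delta η)^[i] α (M + 1 + j) t * x ^ (j + 1)) =
        truncation (jet n η α) (M + (k + 1 + N) + 1) t x := by
      rw [show M + (k + 1 + N) + 1 = M + 1 + (k + 1 + N) by ring,
        truncation_add (M + 1) (k + 1 + N)]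
      congr 2
      funext i
      simp only [Pi.smul_apply, smul_eq_mul, Finset.mul_sum]
      exact Finset.sum_congr rfl fun j _ => by simp only [jet]; ring
    simp only [fixedPointMap, htr, Fin.val_last, sub_sub_cancel_left, norm_neg]
    have h1 := hbound x (by simpa using hx.2.trans_le (min_le_left _ _)) t ht
    rw [div_eq_mul_inv _ (b _ t), norm_mul, norm_div, norm_pow]
    have h2 : ‖F (truncation (jet n η α) (M + (k + 1 + N) + 1) t x)‖ / ‖x‖ ^ (M + N) ≤
        C * ‖x‖ ^ (k + 2) := by
      rw [div_le_iff₀ (by positivity)]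
      exact h1.trans_eq (by ring)
    calc _ ≤ C * ‖x‖ ^ (k + 2) * |γ| :=
          mul_le_mul h2 ((hγ t ht).trans (le_abs_self _)) (norm_nonneg _) (by positivity)
      _ = _ := by ring

end

/-! ### Branches of `x ^ (iη)` on a sector -/

theorem branchLog_mul_exp {R θ : ℝ} (hR : 0 < R) (hθ : 0 < θ) (hθ' : θ < 2 * Real.pi) (m : ℤ) :
    branchLog m (R * Complex.exp (θ * Complex.I)) =
      Real.log R + (θ + 2 * m * Real.pi) * Complex.I := by
  have h1 : -((R : ℂ) * Complex.exp (θ * Complex.I)) =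
      R * Complex.exp ((θ - Real.pi : ℝ) * Complex.I) := by
    push_cast
    rw [sub_mul, Complex.exp_sub, Complex.exp_pi_mul_I]
    ring
  rw [branchLog, h1, Complex.log_ofReal_mul hR (Complex.exp_ne_zero _), Complex.log_exp]
  · push_cast; ring
  · simp; linarith
  · simp; linarith

theorem norm_branchPow_mul_exp {R θ : ℝ} (hR : 0 < R) (hθ : 0 < θ) (hθ' : θ < 2 * Real.pi) (m : ℤ)
    (η : ℝ) : ‖branchPow m η (R * Complex.exp (θ * Complex.I))‖ =
      Real.exp (-(η * (θ + 2 * m * Real.pi))) := by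
  rw [branchPow, branchLog_mul_exp hR hθ hθ', Complex.norm_exp]
  congr 1
  simp [mul_comm, mul_left_comm]

theorem exists_int_mul_gt {η : ℝ} (hη : η ≠ 0) (X : ℝ) : ∃ m : ℤ, X < η * m := by
  rcases lt_or_gt_of_ne hη with h | h
  · obtain ⟨m, hm⟩ := exists_int_lt (X / η)
    exact ⟨m, by rwa [lt_div_iff_of_neg' h] at hm⟩
  · obtain ⟨m, hm⟩ := exists_int_gt (X / η)
    exact ⟨m, by rwa [div_lt_iff₀' h] at hm⟩

/-- Suitable branches of `x ^ (iη)` map a sector into an annulus contained in a given punctured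
disc. -/
theorem exists_branchPow_mem_annulus {η : ℝ} (hη : η ≠ 0) {r : ℝ} (hr : 0 < r) :
    ∃ (m : ℤ) (a c : ℝ), 0 < a ∧ c < r ∧ ∀ R, ∀ x ∈ openSector R 1 2,
      a ≤ ‖branchPow m η x‖ ∧ ‖branchPow m η x‖ ≤ c := by
  -- For `1 < θ < 2` the exponent `-(η * θ)` stays within `2 * |η|`; the shift `-2πηm` then
  -- outweighs it together with `log r`.
  obtain ⟨m, hm⟩ := exists_int_mul_gt hη (|Real.log r| + 2 * |η|)
  have hpi : 3 < Real.pi := Real.pi_gt_three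
  refine ⟨m, Real.exp (-(2 * |η|) - 2 * Real.pi * (η * m)),
    Real.exp (2 * |η| - 2 * Real.pi * (η * m)), Real.exp_pos _, ?_, ?_⟩
  · rw [← Real.lt_log_iff_exp_lt hr]
    have h1 : 0 ≤ η * m := (by positivity : (0 : ℝ) ≤ |Real.log r| + 2 * |η|).trans hm.le
    nlinarith [neg_abs_le (Real.log r)]
  · rintro R x ⟨ρ, θ, hρ, -, h1, h2, rfl⟩
    rw [norm_branchPow_mul_exp hρ (by linarith) (by linarith), Real.exp_le_exp, Real.exp_le_exp]
    have h3 : |η * θ| ≤ 2 * |η| := by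
      rw [abs_mul, abs_of_pos (by linarith : 0 < θ), mul_comm]
      exact mul_le_mul_of_nonneg_right h2.le (abs_nonneg _)
    have h4 := abs_le.1 h3
    constructor <;> nlinarith

theorem openSector_one_two_subset (R : ℝ) : openSector R 1 2 ⊆ nonnegRayᶜ := by
  rintro x ⟨ρ, θ, hρ, -, h1, h2, rfl⟩ ⟨-, him⟩
  have hsin : 0 < Real.sin θ :=
    Real.sin_pos_of_pos_of_lt_pi (by linarith) (by linarith [Real.pi_gt_three])
  have : ((ρ : ℂ) * Complex.exp (θ * Complex.I)).im = ρ * Real.sin θ := by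
    rw [Complex.im_ofReal_mul, Complex.exp_ofReal_mul_I_im]
  rw [this] at him
  exact (mul_pos hρ hsin).ne' him

theorem norm_lt_of_mem_openSector {R θ₁ θ₂ : ℝ} {x : ℂ} (hx : x ∈ openSector R θ₁ θ₂) :
    ‖x‖ < R := by
  obtain ⟨ρ, θ, hρ, h, -, -, rfl⟩ := hx
  rw [norm_mul, Complex.norm_exp_ofReal_mul_I, mul_one, Complex.norm_real, Real.norm_eq_abs,
    abs_of_pos hρ]
  exact h

theorem isCompact_annulus (a c : ℝ) : IsCompact {t : ℂ | a ≤ ‖t‖ ∧ ‖t‖ ≤ c} := by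
  have : {t : ℂ | a ≤ ‖t‖ ∧ ‖t‖ ≤ c} = {t | a ≤ ‖t‖} ∩ Metric.closedBall 0 c := by
    ext t; simp
  rw [this]
  exact (isCompact_closedBall _ _).inter_left (isClosed_le continuous_const continuous_norm)

theorem rotInvariant_annulus (a c : ℝ) : RotInvariant {t : ℂ | a ≤ ‖t‖ ∧ ‖t‖ ≤ c} := by
  intro t ht z hz
  simpa [hz] using ht

theorem exists_puncturedDisc_of_eventually {P : ℂ → Prop} (h : ∀ᶠ t in 𝓝[≠] (0 : ℂ), P t) :
    ∃ r > 0, ∀ t ∈ puncturedDisc r, P t := by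
  obtain ⟨r, hr, hsub⟩ := (nhdsWithin_hasBasis Metric.nhds_basis_ball _).mem_iff.1 h
  exact ⟨r, hr, fun t ht => hsub ⟨by simpa using ht.2, norm_pos_iff.1 ht.1⟩⟩

end Exotic

end

/-! ### Convergence on the sector -/

theorem theorem1 {n : ℕ} (ρ : ℝ) (hρ : 0 < ρ)
    (ε : Fin (n + 1) → ℝ≥0∞) (hε : ∀ j, 0 < ε j)
    (F : ℂ × (Fin (n + 1) → ℂ) → ℂ) (hF : AnalyticOnNhd ℂ F (Exotic.polydisc ρ ε))
    (η : ℝ) (hη : η ≠ 0) (r : ℝ) (hr : 0 < r)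
    (α : ℕ → ℂ → ℂ) (hα : Exotic.IsExoticSeries r α)
    (hsol : Exotic.IsFormalSolution (Exotic.polydisc ρ ε) F η α)
    (N : ℕ) (B : Fin (n + 1) → ℂ → ℂ) (hB : ∀ i, MeromorphicAt (B i) 0)
    (hform : ∀ i, ∀ᶠ t in 𝓝[≠] (0 : ℂ),
      (∀ k < N, Exotic.substCoeff (Exotic.partialY F i) (Exotic.jet n η α) k t = 0) ∧
        Exotic.substCoeff (Exotic.partialY F i) (Exotic.jet n η α) N t = B i t)
    (hBn : ¬ ∀ᶠ t in 𝓝[≠] (0 : ℂ), B (Fin.last n) t = 0)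
    (hord : ∀ i, meromorphicOrderAt (B (Fin.last n)) 0 ≤ meromorphicOrderAt (B i) 0) :
    ∃ R θ₁ θ₂ : ℝ, 0 < R ∧ θ₁ < θ₂ ∧ Exotic.openSector R θ₁ θ₂ ⊆ Exotic.nonnegRayᶜ ∧
      ∃ m : ℤ,
        (∀ x ∈ Exotic.openSector R θ₁ θ₂, Exotic.branchPow m η x ∈ Exotic.puncturedDisc r) ∧
        ∃ f : ℂ → ℂ, TendstoUniformlyOn
          (fun (K : ℕ) (x : ℂ) => ∑ k ∈ Finset.range K, α k (Exotic.branchPow m η x) * x ^ k)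
          f atTop (Exotic.openSector R θ₁ θ₂) := by
  have hne : ∀ᶠ t in 𝓝[≠] (0 : ℂ), B (Fin.last n) t ≠ 0 :=
    (hB (Fin.last n)).eventually_eq_zero_or_eventually_ne_zero.resolve_left hBn
  obtain ⟨r₁, hr₁, hgood⟩ := Exotic.exists_puncturedDisc_of_eventually
    (((hsol.and (eventually_all.2 hform)).and hne).and
      (eventually_all.2 fun i => (hB i).eventually_analyticAt))
  obtain ⟨m, a, c, ha, hc, hsector⟩ := Exotic.exists_branchPow_mem_annulus hη (lt_min hr hr₁)
  set A : Set ℂ := {t : ℂ | a ≤ ‖t‖ ∧ ‖t‖ ≤ c} with hAdef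
  have hA : IsCompact A := Exotic.isCompact_annulus a c
  have hAr : A ⊆ Exotic.puncturedDisc r := fun t ht =>
    ⟨ha.trans_le ht.1, (ht.2.trans_lt hc).trans_le (min_le_left _ _)⟩
  have hAg := fun t (ht : t ∈ A) => hgood t
    ⟨ha.trans_le ht.1, (ht.2.trans_lt hc).trans_le (min_le_right _ _)⟩
  have hαd := fun k => (hα k).2
  obtain ⟨M, s, hs, hbound⟩ := Exotic.exists_norm_coeff_le (Exotic.isOpen_polydisc ρ ε) hF hA
    (Exotic.rotInvariant_annulus a c) hAr hαd (fun t ht => (hAg t ht).1.1.1.1)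
    (fun t ht => (hAg t ht).1.1.1.2)
    (b := B) (fun i t ht => ((hAg t ht).2 i).continuousAt.continuousWithinAt)
    (fun t ht i => ((hAg t ht).1.1.2 i).1) (fun t ht i => ((hAg t ht).1.1.2 i).2)
    (fun t ht => (hAg t ht).1.2)
  -- Radius `s / 4` gives `(2 / s) ^ (j + 1) * (s / 4) ^ j = (2 / s) * (1 / 2) ^ j`; radius at most
  -- `1` allows the surplus factor `x ^ (M + 1)` to be dropped.
  refine ⟨min 1 (s / 4), 1, 2, by positivity, by norm_num, Exotic.openSector_one_two_subset _, m,
    fun x hx => hAr (hsector _ x hx), ?_⟩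
  choose β hβ using fun k => hA.exists_bound_of_continuousOn ((hαd k).continuousOn.mono hAr)
  -- The first `M + 1` coefficients are outside the geometric estimate and are bounded on `A` by
  -- compactness.
  set u : ℕ → ℝ := fun k => if k < M + 1 then |β k| else 2 / s * (1 / 2) ^ (k - (M + 1)) with hu
  have hsum : Summable u := by
    rw [← summable_nat_add_iff (M + 1)]
    have : (fun k => u (k + (M + 1))) = fun k => 2 / s * (1 / 2) ^ k := by
      funext k
      simp only [hu]
      rw [if_neg (by omega), Nat.add_sub_cancel]
    rw [this]
    exact (summable_geometric_of_lt_one (by norm_num) (by norm_num)).mul_left _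
  refine ⟨_, tendstoUniformlyOn_tsum_nat hsum fun k x hx => ?_⟩
  have hxA : Exotic.branchPow m η x ∈ A := hsector _ x hx
  have hxR := Exotic.norm_lt_of_mem_openSector hx
  have hx1 : ‖x‖ ≤ 1 := hxR.le.trans (min_le_left _ _)
  have hxs : ‖x‖ ≤ s / 4 := hxR.le.trans (min_le_right _ _)
  rw [norm_mul, norm_pow]
  by_cases hk : k < M + 1
  · simp only [hu, if_pos hk]
    exact (mul_le_of_le_one_right (norm_nonneg _) (pow_le_one₀ (norm_nonneg _) hx1)).trans
      ((hβ k _ hxA).trans (le_abs_self _))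
  · obtain ⟨j, rfl⟩ : ∃ j, k = M + 1 + j := ⟨k - (M + 1), by omega⟩
    simp only [hu, if_neg hk, Nat.add_sub_cancel_left]
    have h1 : ‖x‖ ^ (M + 1 + j) ≤ (s / 4) ^ j := by
      rw [pow_add]
      exact (mul_le_of_le_one_left (by positivity) (pow_le_one₀ (norm_nonneg _) hx1)).trans
        (pow_le_pow_left₀ (norm_nonneg _) hxs j)
    refine (mul_le_mul (hbound _ hxA j) h1 (by positivity) (by positivity)).trans_eq ?_
    rw [pow_succ', mul_assoc, ← mul_pow]
    congr 2
    field_simp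
    norm_num
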